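/- Let $\Omega\subset\mathbb R^4$ be a bounded open set with $0\in\Omega$, and put $\Omega'=\Omega\setminus\{0\}$. Let $f:[0,\infty)\to[0,\infty)$ be continuous and nondecreasing with $f(0)=0$ and $$\lim_{t\to\infty}\frac{f(t)}{t^2}=c\in(0,\infty].$$ Let $a\ge 0$ be a measurable function in $L^k(\Omega)$ for some $k>\tfrac43$, and suppose that $\operatorname{ess\,inf}_{B_{r_0}\cap\Omega}a>0$ for some $r_0>0$, where $B_{r_0}$ is the ball of radius $r_0$ about $0$. Let $u$ solve problem $(P)$; that is, $u,\Delta u,\Delta^2u\in L^1_{\rm loc}(\Omega')$ (derivatives in the sense of distributions), $\Delta^2u=a(x)f(u)$ in $\mathcal D'(\Omega')$, and $u\ge0$, $-\Delta u\ge0$ a.e. in $\Omega'$. Then $u$ and $a(x)f(u)$ belong to $L^1_{\rm loc}(\Omega)$, and there is a constant $\alpha\ge0$ such that $$\Delta^2u=a(x)f(u)+\alpha\,\delta_0\quad\text{in }\mathcal D'(\Omega).$$ Moreover, whenever $\Delta^2u=a(x)f(u)+\alpha\,\delta_0-\beta\,\Delta\delta_0$ in $\mathcal D'(\Omega)$ with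 real constants $\alpha,\beta$, one has $\beta=0$. -/

import Mathlib

open Filter Topology MeasureTheory TopologicalSpace Set
open scoped Distributions Laplacian ENNReal

/-- Four-dimensional Euclidean space. -/
abbrev E4 : Type := EuclideanSpace ℝ (Fin 4)

/-- The punctured open set `Ω' = Ω \ {0}`. -/
def punctured (Ω : Opens E4) : Opens E4 :=
  ⟨(Ω : Set E4) \ {0}, Ω.isOpen.sdiff isClosed_singleton⟩

/-- `f : [0, ∞) → [0, ∞)` is continuous and nondecreasing with `f 0 = 0`.
The values of `f` at negative arguments play no role. -/
structure IsNonlinearity (f : ℝ → ℝ) : Prop where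
  nonneg : ∀ t, 0 ≤ t → 0 ≤ f t
  continuousOn : ContinuousOn f (Ici 0)
  monotoneOn : MonotoneOn f (Ici 0)
  map_zero : f 0 = 0

/-- `a` is a nonnegative (measurable) function in `L^k(Ω)` for some `k > 4/3`,
and its essential infimum over some ball about the origin is positive
(`a` matters only on `Ω`). -/
structure IsWeight (Ω : Opens E4) (a : E4 → ℝ) : Prop where
  nonneg : ∀ᵐ x ∂(volume.restrict (Ω : Set E4)), 0 ≤ a x
  memLp : ∃ k : ℝ≥0∞, 4 / 3 < k ∧ MemLp a k (volume.restrict (Ω : Set E4))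
  essInf_pos : ∃ r₀ > (0 : ℝ), ∃ m > (0 : ℝ),
    ∀ᵐ x ∂(volume.restrict (Metric.ball (0 : E4) r₀ ∩ (Ω : Set E4))), m ≤ a x

/-- `Δ u = v` in `𝓓'(U)`, for functions `u, v ∈ L¹_loc(U)`. -/
structure HasWeakLaplacian (U : Opens E4) (u v : E4 → ℝ) : Prop where
  locallyIntegrableOn_left : LocallyIntegrableOn u (U : Set E4)
  locallyIntegrableOn_right : LocallyIntegrableOn v (U : Set E4)
  integral_eq : ∀ φ : 𝓓(U, ℝ),
    ∫ x in (U : Set E4), u x * Δ (φ : E4 → ℝ) x = ∫ x in (U : Set E4), v x * φ x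

/-- `Δ² u = g` in `𝓓'(U)`, for functions `u, g ∈ L¹_loc(U)`. -/
structure HasWeakBilaplacian (U : Opens E4) (u g : E4 → ℝ) : Prop where
  locallyIntegrableOn_left : LocallyIntegrableOn u (U : Set E4)
  locallyIntegrableOn_right : LocallyIntegrableOn g (U : Set E4)
  integral_eq : ∀ φ : 𝓓(U, ℝ),
    ∫ x in (U : Set E4), u x * Δ (Δ (φ : E4 → ℝ)) x = ∫ x in (U : Set E4), g x * φ x

/-- `u`, `Δ u`, `Δ² u` belong to `L¹_loc(Ω')`, `Δ² u = a f(u)` in `𝓓'(Ω')`, and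
`u ≥ 0`, `-Δ u ≥ 0` almost everywhere in `Ω'`. -/
structure SolvesP (Ω : Opens E4) (a : E4 → ℝ) (f : ℝ → ℝ) (u : E4 → ℝ) : Prop where
  nonneg : ∀ᵐ x ∂(volume.restrict (punctured Ω : Set E4)), 0 ≤ u x
  neg_laplacian_nonneg : ∃ v : E4 → ℝ, HasWeakLaplacian (punctured Ω) u v ∧
    ∀ᵐ x ∂(volume.restrict (punctured Ω : Set E4)), 0 ≤ -v x
  bilaplacian_eq : HasWeakBilaplacian (punctured Ω) u (fun x => a x * f (u x))

/-- `u, a f(u) ∈ L¹_loc(Ω)` and `Δ² u = a f(u) + α δ₀ - β Δ δ₀` in `𝓓'(Ω)`.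
Here `⟨δ₀, φ⟩ = φ 0` and `⟨Δ δ₀, φ⟩ = Δ φ 0`. -/
structure SolvesWithDirac (Ω : Opens E4) (a : E4 → ℝ) (f : ℝ → ℝ) (u : E4 → ℝ) (α β : ℝ) :
    Prop where
  locallyIntegrableOn_left : LocallyIntegrableOn u (Ω : Set E4)
  locallyIntegrableOn_right : LocallyIntegrableOn (fun x => a x * f (u x)) (Ω : Set E4)
  integral_eq : ∀ φ : 𝓓(Ω, ℝ),
    ∫ x in (Ω : Set E4), u x * Δ (Δ (φ : E4 → ℝ)) x =
      (∫ x in (Ω : Set E4), a x * f (u x) * φ x) + α * φ 0 - β * Δ (φ : E4 → ℝ) 0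

/-! The argument applies a Brezis–Lions theorem twice. If `w, g ≥ 0` satisfy `-Δ w = g` off the
origin, then both are integrable near `0` and `Δ w + g = -α δ₀` on all of `Ω` with `α ≥ 0`
(`exists_dirac`). The pair `(u, -Δ u)` gives `Δ u = v - β δ₀`, where `v` is the punctured Laplacian,
and the pair `(-v, a f(u))` gives `Δ v = a f(u) + α δ₀`. Composing, `Δ² u = a f(u) + α δ₀ - β Δ δ₀`,
so everything reduces to `β = 0`.

For that, quadratic growth of `f` and the lower bound on `a` turn integrability of `a f(u)` into `u
∈ L²` near `0` (`exists_integrableOn_sq`). Testing with a cutoff at scale `ε` bounds `β` by about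
`ε⁻² ∫_{B_ε} u` plus a vanishing term. In dimension four the ball has volume of order `ε⁴`, so by
Cauchy–Schwarz this is at most a constant times `‖u‖_{L²(B_ε)}`, which tends to `0`
(`eq_zero_of_integrableOn_sq`).

The Brezis–Lions theorem rests on smooth subharmonic barriers vanishing near `0`, built from `1 +
δ|x| - ε²/|x|²`. With `δ = 1` they give integrability of `w/|x|` and `g` (`integrableOn_ball`). The
weight `1/|x|` rules out derivatives of `δ₀` (`laplacianPairing_eq_zero`), and `δ = 0` gives the
sign of `α` (`laplacianPairing_cutoff_nonpos`). -/

open scoped ContDiff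

/-! ### Pointwise calculus of the Laplacian -/

/-- The pairing `∇ f · ∇ g` in four-dimensional Euclidean space. -/
noncomputable def gradDot (f g : E4 → ℝ) (x : E4) : ℝ :=
  ∑ i, fderiv ℝ f x (EuclideanSpace.basisFun (Fin 4) ℝ i) *
    fderiv ℝ g x (EuclideanSpace.basisFun (Fin 4) ℝ i)

lemma laplacian_eq_sum_fderiv (f : E4 → ℝ) (x : E4) :
    Δ f x = ∑ i, fderiv ℝ (fderiv ℝ f) x (EuclideanSpace.basisFun (Fin 4) ℝ i)
      (EuclideanSpace.basisFun (Fin 4) ℝ i) := by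
  rw [InnerProductSpace.laplacian_eq_iteratedFDeriv_orthonormalBasis f
    (EuclideanSpace.basisFun (Fin 4) ℝ)]
  simp [iteratedFDeriv_two_apply]

lemma abs_gradDot_le (f g : E4 → ℝ) (x : E4) :
    |gradDot f g x| ≤ 4 * (‖fderiv ℝ f x‖ * ‖fderiv ℝ g x‖) := by
  have h : ∀ (L : E4 →L[ℝ] ℝ) (i : Fin 4), |L (EuclideanSpace.basisFun (Fin 4) ℝ i)| ≤ ‖L‖ := by
    intro L i
    simpa using L.le_opNorm (EuclideanSpace.basisFun (Fin 4) ℝ i)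
  calc |gradDot f g x| ≤ ∑ i : Fin 4, ‖fderiv ℝ f x‖ * ‖fderiv ℝ g x‖ := by
        refine (Finset.abs_sum_le_sum_abs _ _).trans (Finset.sum_le_sum fun i _ => ?_)
        rw [abs_mul]
        exact mul_le_mul (h _ i) (h _ i) (abs_nonneg _) (norm_nonneg _)
    _ = _ := by simp

lemma differentiableAt_fderiv {f : E4 → ℝ} {x : E4} (hf : ContDiffAt ℝ 2 f x) :
    DifferentiableAt ℝ (fderiv ℝ f) x :=
  (hf.fderiv_right (m := 1) (by norm_num)).differentiableAt (by norm_num)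

lemma laplacian_mul {f g : E4 → ℝ} {x : E4} (hf : ContDiffAt ℝ 2 f x) (hg : ContDiffAt ℝ 2 g x) :
    Δ (fun y => f y * g y) x = f x * Δ g x + 2 * gradDot f g x + g x * Δ f x := by
  have h : fderiv ℝ (fun y => f y * g y) =ᶠ[𝓝 x]
      fun y => f y • fderiv ℝ g y + g y • fderiv ℝ f y := by
    filter_upwards [hf.eventually (by simp), hg.eventually (by simp)] with y hy hy'
    exact fderiv_fun_mul (hy.differentiableAt (by norm_num)) (hy'.differentiableAt (by norm_num))
  have hf1 := (hf.differentiableAt (by norm_num)).hasFDerivAt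
  have hg1 := (hg.differentiableAt (by norm_num)).hasFDerivAt
  have h2 := ((hf1.smul (differentiableAt_fderiv hg).hasFDerivAt).add
    (hg1.smul (differentiableAt_fderiv hf).hasFDerivAt)).fderiv
  rw [laplacian_eq_sum_fderiv, laplacian_eq_sum_fderiv, laplacian_eq_sum_fderiv, gradDot,
    h.fderiv_eq]
  erw [h2]
  simp only [Finset.mul_sum, ← Finset.sum_add_distrib]
  refine Finset.sum_congr rfl fun i _ => ?_
  simp
  ring

lemma laplacian_comp {F : ℝ → ℝ} {z : E4 → ℝ} {x : E4} (hF : ContDiffAt ℝ 2 F (z x))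
    (hz : ContDiffAt ℝ 2 z x) :
    Δ (fun y => F (z y)) x = deriv F (z x) * Δ z x + deriv (deriv F) (z x) * gradDot z z x := by
  have h : fderiv ℝ (fun y => F (z y)) =ᶠ[𝓝 x] fun y => deriv F (z y) • fderiv ℝ z y := by
    filter_upwards [hz.eventually (by simp), hz.continuousAt.eventually (hF.eventually (by simp))]
      with y hy hy'
    exact (((hy'.differentiableAt (by norm_num)).hasDerivAt).comp_hasFDerivAt y
      (hy.differentiableAt (by norm_num)).hasFDerivAt).fderiv
  have hF' : DifferentiableAt ℝ (deriv F) (z x) := by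
    have : ContDiffAt ℝ 1 (fun t => fderiv ℝ F t 1) (z x) :=
      (hF.fderiv_right (m := 1) (by norm_num)).clm_apply contDiffAt_const
    exact this.differentiableAt (by norm_num)
  have hz1 := (hz.differentiableAt (by norm_num)).hasFDerivAt
  have h2 := ((hF'.hasDerivAt.comp_hasFDerivAt x hz1).smul
    (differentiableAt_fderiv hz).hasFDerivAt).fderiv
  rw [laplacian_eq_sum_fderiv, laplacian_eq_sum_fderiv, gradDot, h.fderiv_eq]
  erw [h2]
  simp only [Finset.mul_sum, ← Finset.sum_add_distrib]
  refine Finset.sum_congr rfl fun i _ => ?_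
  simp
  ring

lemma laplacian_comp_smul (f : E4 → ℝ) (c : ℝ) (x : E4) :
    Δ (fun y => f (c • y)) x = c ^ 2 * Δ f (c • x) := by
  have h : fderiv ℝ (fun y => f (c • y)) = fun y => c • fderiv ℝ f (c • y) := by
    ext1 y
    exact fderiv_comp_smul c
  rw [laplacian_eq_sum_fderiv, laplacian_eq_sum_fderiv, h, Finset.mul_sum]
  refine Finset.sum_congr rfl fun i _ => ?_
  have h2 : fderiv ℝ (fun y => c • fderiv ℝ f (c • y)) x =
      c • fderiv ℝ (fun y => fderiv ℝ f (c • y)) x :=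
    congrFun (fderiv_const_smul_field (𝕜 := ℝ) (f := fun y => fderiv ℝ f (c • y)) c) x
  rw [h2, fderiv_comp_smul c]
  simp
  ring

lemma contDiff_laplacian {f : E4 → ℝ} (hf : ContDiff ℝ ∞ f) : ContDiff ℝ ∞ (Δ f) := by
  have h : Δ f = fun x => ∑ i, fderiv ℝ (fderiv ℝ f) x (EuclideanSpace.basisFun (Fin 4) ℝ i)
      (EuclideanSpace.basisFun (Fin 4) ℝ i) := funext (laplacian_eq_sum_fderiv f)
  rw [h]
  have h1 : ContDiff ℝ ∞ (fderiv ℝ f) := hf.fderiv_right (by simp)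
  have h2 : ContDiff ℝ ∞ (fderiv ℝ (fderiv ℝ f)) := h1.fderiv_right (by simp)
  exact ContDiff.sum fun i _ => (h2.clm_apply contDiff_const).clm_apply contDiff_const

lemma laplacian_eq_of_eventuallyEq {f g : E4 → ℝ} {x : E4} (h : f =ᶠ[𝓝 x] g) :
    Δ f x = Δ g x :=
  (InnerProductSpace.laplacian_congr_nhds h).eq_of_nhds

lemma laplacian_eq_zero_of_eventuallyEq_const {f : E4 → ℝ} {x : E4} {c : ℝ}
    (h : f =ᶠ[𝓝 x] fun _ => c) : Δ f x = 0 := by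
  rw [laplacian_eq_of_eventuallyEq h, InnerProductSpace.laplacian_const]
  rfl

lemma tsupport_laplacian_subset (f : E4 → ℝ) : tsupport (Δ f) ⊆ tsupport f := by
  refine closure_minimal (fun x hx => ?_) (isClosed_tsupport f)
  by_contra h
  exact hx (laplacian_eq_zero_of_eventuallyEq_const (notMem_tsupport_iff_eventuallyEq.1 h))

lemma hasCompactSupport_laplacian {f : E4 → ℝ} (hf : HasCompactSupport f) :
    HasCompactSupport (Δ f) :=
  hf.mono' ((subset_tsupport _).trans (tsupport_laplacian_subset f))

lemma fderiv_normSq_basisFun (x : E4) (i : Fin 4) :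
    fderiv ℝ (fun y : E4 => ‖y‖ ^ 2) x (EuclideanSpace.basisFun (Fin 4) ℝ i) = 2 * x i := by
  rw [fderiv_norm_sq_apply]
  simp [EuclideanSpace.inner_single_right]

lemma laplacian_normSq (x : E4) : Δ (fun y : E4 => ‖y‖ ^ 2) x = 8 := by
  rw [laplacian_eq_sum_fderiv, fderiv_norm_sq]
  have : fderiv ℝ (2 • ⇑(innerSL ℝ (E := E4))) x = 2 • (innerSL ℝ (E := E4)) :=
    ContinuousLinearMap.fderiv (2 • (innerSL ℝ (E := E4)))
  have h1 : ∀ i : Fin 4, innerSL ℝ (EuclideanSpace.basisFun (Fin 4) ℝ i)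
      (EuclideanSpace.basisFun (Fin 4) ℝ i) = 1 := fun i => by
    rw [innerSL_apply_apply, real_inner_self_eq_norm_sq]
    simp
  rw [this]
  calc ∑ i : Fin 4, (2 • innerSL ℝ (E := E4)) (EuclideanSpace.basisFun (Fin 4) ℝ i)
        (EuclideanSpace.basisFun (Fin 4) ℝ i)
      = ∑ i : Fin 4, 2 * innerSL ℝ (EuclideanSpace.basisFun (Fin 4) ℝ i)
        (EuclideanSpace.basisFun (Fin 4) ℝ i) := by simp
    _ = 8 := by
      simp only [h1]
      norm_num

lemma gradDot_normSq (x : E4) :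
    gradDot (fun y : E4 => ‖y‖ ^ 2) (fun y : E4 => ‖y‖ ^ 2) x = 4 * ‖x‖ ^ 2 := by
  simp only [gradDot, fderiv_normSq_basisFun]
  rw [EuclideanSpace.norm_sq_eq, Finset.mul_sum]
  refine Finset.sum_congr rfl fun i _ => ?_
  rw [Real.norm_eq_abs, sq_abs]
  ring

lemma gradDot_self_nonneg (f : E4 → ℝ) (x : E4) : 0 ≤ gradDot f f x :=
  Finset.sum_nonneg fun _ _ => mul_self_nonneg _


/-! ### Subharmonic barriers vanishing near the origin -/

/-- A smooth convex nondecreasing function vanishing on `(-∞, 0]`, with slope one on `[1, ∞)`. -/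
noncomputable def smoothRamp (t : ℝ) : ℝ := ∫ s in (0 : ℝ)..t, Real.smoothTransition s

lemma hasDerivAt_smoothRamp (t : ℝ) : HasDerivAt smoothRamp (Real.smoothTransition t) t :=
  intervalIntegral.integral_hasDerivAt_right
    (Real.smoothTransition.continuous.intervalIntegrable _ _)
    Real.smoothTransition.continuous.stronglyMeasurable.stronglyMeasurableAtFilter
    Real.smoothTransition.continuousAt

lemma deriv_smoothRamp : deriv smoothRamp = Real.smoothTransition :=
  funext fun t => (hasDerivAt_smoothRamp t).deriv

lemma contDiff_smoothRamp : ContDiff ℝ ∞ smoothRamp := by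
  rw [contDiff_infty_iff_deriv, deriv_smoothRamp]
  exact ⟨fun t => (hasDerivAt_smoothRamp t).differentiableAt, Real.smoothTransition.contDiff⟩

lemma monotone_smoothRamp : Monotone smoothRamp :=
  monotone_of_deriv_nonneg (fun t => (hasDerivAt_smoothRamp t).differentiableAt)
    fun t => by rw [deriv_smoothRamp]; exact Real.smoothTransition.nonneg t

lemma smoothRamp_of_nonpos {t : ℝ} (ht : t ≤ 0) : smoothRamp t = 0 := by
  rw [smoothRamp, intervalIntegral.integral_congr (g := fun _ => 0)]
  · simp
  · intro s hs
    rw [uIcc_of_ge ht] at hs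
    exact Real.smoothTransition.zero_of_nonpos hs.2

lemma smoothRamp_nonneg (t : ℝ) : 0 ≤ smoothRamp t := by
  rcases le_total t 0 with h | h
  · rw [smoothRamp_of_nonpos h]
  · rw [← smoothRamp_of_nonpos le_rfl]
    exact monotone_smoothRamp h

lemma smoothRamp_le {t : ℝ} (ht : 0 ≤ t) : smoothRamp t ≤ t := by
  have := intervalIntegral.integral_mono_on (f := Real.smoothTransition) (g := fun _ => (1 : ℝ)) (μ := volume) ht
    (Real.smoothTransition.continuous.intervalIntegrable _ _) intervalIntegrable_const
    fun s _ => Real.smoothTransition.le_one s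
  simpa [smoothRamp] using this

lemma smoothRamp_one_pos : 0 < smoothRamp 1 :=
  intervalIntegral.intervalIntegral_pos_of_pos_on
    (Real.smoothTransition.continuous.intervalIntegrable _ _)
    (fun _ hs => Real.smoothTransition.pos_of_pos hs.1) one_pos

lemma deriv_smoothTransition_nonneg (t : ℝ) : 0 ≤ deriv Real.smoothTransition t :=
  Real.smoothTransition.monotone.deriv_nonneg

/-- The profile `1 + δ √ρ - ε² / ρ` of the barrier, as a function of `ρ = |x|²`. -/
noncomputable def barrierProfile (δ ε ρ : ℝ) : ℝ := 1 + δ * √ρ - ε ^ 2 * ρ⁻¹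

lemma contDiffAt_barrierProfile (δ ε : ℝ) {ρ : ℝ} (hρ : 0 < ρ) {n : WithTop ℕ∞} :
    ContDiffAt ℝ n (barrierProfile δ ε) ρ := by
  unfold barrierProfile
  exact (contDiffAt_const.add (contDiffAt_const.mul (contDiffAt_id.sqrt hρ.ne'))).sub
    (contDiffAt_const.mul (contDiffAt_id.inv hρ.ne'))

lemma deriv_barrierProfile (δ ε : ℝ) {ρ : ℝ} (hρ : 0 < ρ) :
    deriv (barrierProfile δ ε) ρ = δ * (1 / (2 * √ρ)) + ε ^ 2 * (ρ ^ 2)⁻¹ := by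
  have h := (((Real.hasDerivAt_sqrt hρ.ne').const_mul δ).const_add 1).sub
    ((hasDerivAt_inv hρ.ne').const_mul (ε ^ 2))
  have := HasDerivAt.deriv (f := barrierProfile δ ε) h
  rw [this]
  ring

lemma deriv_deriv_barrierProfile (δ ε : ℝ) {ρ : ℝ} (hρ : 0 < ρ) :
    deriv (deriv (barrierProfile δ ε)) ρ =
      -(δ * (1 / (4 * (ρ * √ρ)))) - 2 * ε ^ 2 * (ρ ^ 3)⁻¹ := by
  have h : deriv (barrierProfile δ ε) =ᶠ[𝓝 ρ]
      fun ρ => δ * (2 * √ρ)⁻¹ + ε ^ 2 * (ρ ^ 2)⁻¹ := by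
    filter_upwards [lt_mem_nhds hρ] with s hs
    rw [deriv_barrierProfile δ ε hs, one_div]
  have hs : √ρ ≠ 0 := (Real.sqrt_pos.2 hρ).ne'
  have h2 := ((((Real.hasDerivAt_sqrt hρ.ne').const_mul 2).inv (by positivity)).const_mul δ).add
    (((hasDerivAt_pow 2 ρ).inv (by positivity)).const_mul (ε ^ 2))
  rw [h.deriv_eq]
  have := HasDerivAt.deriv (f := fun ρ => δ * (2 * √ρ)⁻¹ + ε ^ 2 * (ρ ^ 2)⁻¹) h2
  rw [this]
  have hq : √ρ ^ 2 = ρ := Real.sq_sqrt hρ.le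
  have e1 : ρ * √ρ = √ρ ^ 3 := by rw [pow_succ, hq]
  rw [e1]
  field_simp
  ring

/-- The profile composed with `|x|²`. -/
noncomputable def barrierArg (δ ε : ℝ) (x : E4) : ℝ := barrierProfile δ ε (‖x‖ ^ 2)

lemma barrierArg_eq (δ ε : ℝ) (x : E4) :
    barrierArg δ ε x = 1 + δ * ‖x‖ - ε ^ 2 * (‖x‖ ^ 2)⁻¹ := by
  rw [barrierArg, barrierProfile, Real.sqrt_sq (norm_nonneg x)]

lemma contDiffAt_barrierArg (δ ε : ℝ) {x : E4} (hx : x ≠ 0) {n : WithTop ℕ∞} :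
    ContDiffAt ℝ n (barrierArg δ ε) x :=
  (contDiffAt_barrierProfile δ ε (ρ := ‖x‖ ^ 2) (by positivity)).comp x
    (contDiff_norm_sq ℝ).contDiffAt

/-- In dimension four `|x|⁻²` is harmonic away from `0`, so only `Δ|x| = 3/|x|` contributes. In
terms of `ρ = |x|²`, the Laplacian of `F(ρ)` is `8F' + 4ρF''`. -/
lemma laplacian_barrierArg (δ ε : ℝ) {x : E4} (hx : x ≠ 0) :
    Δ (barrierArg δ ε) x = 3 * δ / ‖x‖ := by
  have hρ : 0 < ‖x‖ ^ 2 := by positivity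
  have hn : ‖x‖ ≠ 0 := norm_ne_zero_iff.2 hx
  have := laplacian_comp (F := barrierProfile δ ε) (z := fun y : E4 => ‖y‖ ^ 2) (x := x)
    (contDiffAt_barrierProfile δ ε hρ) (contDiff_norm_sq ℝ).contDiffAt
  rw [deriv_barrierProfile δ ε hρ, deriv_deriv_barrierProfile δ ε hρ, laplacian_normSq,
    gradDot_normSq, Real.sqrt_sq (norm_nonneg x)] at this
  refine Eq.trans this ?_
  field_simp
  ring

lemma norm_fderiv_barrierArg_le {δ : ℝ} (hδ : 0 ≤ δ) (ε : ℝ) {x : E4} (hx : x ≠ 0) :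
    ‖fderiv ℝ (barrierArg δ ε) x‖ ≤ δ + 2 * ε ^ 2 * (‖x‖ ^ 3)⁻¹ := by
  have hρ : 0 < ‖x‖ ^ 2 := by positivity
  have hn : ‖x‖ ≠ 0 := norm_ne_zero_iff.2 hx
  have h1 := ((contDiffAt_barrierProfile δ ε hρ (n := 1)).differentiableAt
    (by norm_num)).hasDerivAt.comp_hasFDerivAt (f := fun y : E4 => ‖y‖ ^ 2) x
    ((contDiff_norm_sq ℝ (E := E4) (n := 1)).contDiffAt.differentiableAt (by norm_num)).hasFDerivAt
  have h2 : fderiv ℝ (barrierArg δ ε) x = _ := h1.fderiv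
  rw [h2, deriv_barrierProfile δ ε hρ, Real.sqrt_sq (norm_nonneg x), fderiv_norm_sq_apply,
    norm_smul, Real.norm_of_nonneg (by positivity)]
  have h3 : ‖(2 : ℕ) • innerSL ℝ x‖ ≤ 2 * ‖x‖ := by
    rw [two_nsmul, two_mul]
    exact (norm_add_le _ _).trans (by rw [innerSL_apply_norm])
  refine (mul_le_mul_of_nonneg_left h3 (by positivity)).trans (le_of_eq ?_)
  field_simp

/-- A smooth subharmonic function vanishing near the origin, with
`barrier δ ε x = smoothRamp (1 + δ |x| - ε² / |x|²)` for `x ≠ 0`. -/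
noncomputable def barrier (δ ε : ℝ) (x : E4) : ℝ :=
  if x = 0 then 0 else smoothRamp (barrierArg δ ε x)

section Barrier

variable {δ ε : ℝ} {x : E4}

lemma barrier_of_ne (δ ε : ℝ) (hx : x ≠ 0) : barrier δ ε x = smoothRamp (barrierArg δ ε x) :=
  if_neg hx

lemma barrier_eventuallyEq (δ ε : ℝ) (hx : x ≠ 0) :
    barrier δ ε =ᶠ[𝓝 x] fun y => smoothRamp (barrierArg δ ε y) := by
  filter_upwards [isOpen_ne.mem_nhds hx] with y hy using barrier_of_ne δ ε hy

/-- For `0 < |x| < ε/2` the singular term exceeds `1 + δ|x|`, so the ramp is evaluated at a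
nonpositive argument. This makes a cutoff times the barrier an admissible test function in the
punctured domain. -/
lemma barrier_eventuallyEq_zero (hδ : δ ≤ 1) (hε : 0 < ε) (hε1 : ε ≤ 1) :
    barrier δ ε =ᶠ[𝓝 0] fun _ => 0 := by
  filter_upwards [Metric.ball_mem_nhds (0 : E4) (half_pos hε)] with y hy
  rw [mem_ball_zero_iff] at hy
  by_cases h : y = 0
  · simp [barrier, h]
  rw [barrier_of_ne δ ε h, smoothRamp_of_nonpos]
  have hp : 0 < ‖y‖ := norm_pos_iff.2 h
  rw [barrierArg_eq]
  have h1 : δ * ‖y‖ ≤ 1 := by nlinarith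
  have h2 : 2 ≤ ε ^ 2 * (‖y‖ ^ 2)⁻¹ := by
    rw [← div_eq_mul_inv, le_div_iff₀ (by positivity)]
    nlinarith
  linarith

lemma contDiff_barrier (hδ : δ ≤ 1) (hε : 0 < ε) (hε1 : ε ≤ 1) :
    ContDiff ℝ ∞ (barrier δ ε) := by
  rw [contDiff_iff_contDiffAt]
  intro x
  by_cases hx : x = 0
  · subst hx
    exact contDiffAt_const.congr_of_eventuallyEq (barrier_eventuallyEq_zero hδ hε hε1)
  · exact (contDiff_smoothRamp.contDiffAt.comp x (contDiffAt_barrierArg δ ε hx)).congr_of_eventuallyEq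
      (barrier_eventuallyEq δ ε hx)

lemma barrier_nonneg (δ ε : ℝ) (x : E4) : 0 ≤ barrier δ ε x := by
  unfold barrier
  split_ifs
  exacts [le_rfl, smoothRamp_nonneg _]

lemma barrier_le (hδ : 0 ≤ δ) (ε : ℝ) (x : E4) : barrier δ ε x ≤ 1 + δ * ‖x‖ := by
  have h0 : 0 ≤ 1 + δ * ‖x‖ := by positivity
  unfold barrier
  split_ifs
  · exact h0
  · refine le_trans (monotone_smoothRamp ?_) (smoothRamp_le h0)
    rw [barrierArg_eq]
    have : 0 ≤ ε ^ 2 * (‖x‖ ^ 2)⁻¹ := by positivity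
    linarith

lemma laplacian_barrier (δ ε : ℝ) (hx : x ≠ 0) :
    Δ (barrier δ ε) x = Real.smoothTransition (barrierArg δ ε x) * (3 * δ / ‖x‖) +
      deriv Real.smoothTransition (barrierArg δ ε x) *
        gradDot (barrierArg δ ε) (barrierArg δ ε) x := by
  rw [laplacian_eq_of_eventuallyEq (barrier_eventuallyEq δ ε hx),
    laplacian_comp ((contDiff_infty.1 contDiff_smoothRamp 2).contDiffAt)
      (contDiffAt_barrierArg δ ε hx),
    deriv_smoothRamp, laplacian_barrierArg δ ε hx]

lemma laplacian_barrier_nonneg (hδ : 0 ≤ δ) (ε : ℝ) (hx : x ≠ 0) : 0 ≤ Δ (barrier δ ε) x := by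
  rw [laplacian_barrier δ ε hx]
  have h1 := Real.smoothTransition.nonneg (barrierArg δ ε x)
  have h2 := deriv_smoothTransition_nonneg (barrierArg δ ε x)
  have h3 := gradDot_self_nonneg (barrierArg δ ε) x
  positivity

/-- Under `h` the gain `δ|x|` compensates the loss `ε²/|x|²`, so the ramp has slope one at this
point. For fixed `δ > 0` the region described by `h` exhausts the punctured space as `ε → 0`. -/
lemma one_le_barrierArg (hx : x ≠ 0) (h : ε ^ 2 ≤ δ * ‖x‖ ^ 3) : 1 ≤ barrierArg δ ε x := by
  have hn : 0 < ‖x‖ := norm_pos_iff.2 hx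
  have : ε ^ 2 * (‖x‖ ^ 2)⁻¹ ≤ δ * ‖x‖ := by
    rw [← div_eq_mul_inv, div_le_iff₀ (by positivity)]
    linarith
  rw [barrierArg_eq]
  linarith

lemma le_laplacian_barrier (hx : x ≠ 0) (h : ε ^ 2 ≤ δ * ‖x‖ ^ 3) :
    3 * δ / ‖x‖ ≤ Δ (barrier δ ε) x := by
  rw [laplacian_barrier δ ε hx, Real.smoothTransition.one_of_one_le (one_le_barrierArg hx h)]
  have h2 := deriv_smoothTransition_nonneg (barrierArg δ ε x)
  have h3 := gradDot_self_nonneg (barrierArg δ ε) x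
  have := mul_nonneg h2 h3
  linarith

lemma le_barrier (hx : x ≠ 0) (h : ε ^ 2 ≤ δ * ‖x‖ ^ 3) : smoothRamp 1 ≤ barrier δ ε x := by
  rw [barrier_of_ne δ ε hx]
  exact monotone_smoothRamp (one_le_barrierArg hx h)

lemma norm_fderiv_barrier_le (hδ : 0 ≤ δ) (ε : ℝ) (hx : x ≠ 0) :
    ‖fderiv ℝ (barrier δ ε) x‖ ≤ δ + 2 * ε ^ 2 * (‖x‖ ^ 3)⁻¹ := by
  have h := (hasDerivAt_smoothRamp (barrierArg δ ε x)).comp_hasFDerivAt x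
    ((contDiffAt_barrierArg δ ε hx (n := 1)).differentiableAt (by norm_num)).hasFDerivAt
  rw [(barrier_eventuallyEq δ ε hx).fderiv_eq]
  have h2 : fderiv ℝ (fun y => smoothRamp (barrierArg δ ε y)) x = _ := h.fderiv
  rw [h2, norm_smul, Real.norm_of_nonneg (Real.smoothTransition.nonneg _)]
  exact (mul_le_of_le_one_left (norm_nonneg _) (Real.smoothTransition.le_one _)).trans
    (norm_fderiv_barrierArg_le hδ ε hx)

lemma tendsto_barrier_zero (hx : x ≠ 0) {l : Filter ℕ} {ε : ℕ → ℝ} (hε : Tendsto ε l (𝓝 0)) :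
    Tendsto (fun n => barrier 0 (ε n) x) l (𝓝 (smoothRamp 1)) := by
  have h1 : Tendsto (fun n => 1 + 0 * ‖x‖ - ε n ^ 2 * (‖x‖ ^ 2)⁻¹) l (𝓝 1) := by
    have := (tendsto_const_nhds (x := 1 + 0 * ‖x‖)).sub ((hε.pow 2).mul_const (‖x‖ ^ 2)⁻¹)
    simpa using this
  have h2 := (contDiff_smoothRamp.continuous.tendsto 1).comp h1
  refine h2.congr fun n => ?_
  rw [barrier_of_ne _ _ hx, barrierArg_eq]
  rfl

end Barrier


/-! ### Cutoff functions and their scaling -/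

lemma exists_norm_fderiv_laplacian_le {φ : E4 → ℝ} (hφ : ContDiff ℝ ∞ φ)
    (hc : HasCompactSupport φ) :
    ∃ M : ℝ, 0 ≤ M ∧ ∀ x, |φ x| ≤ M ∧ ‖fderiv ℝ φ x‖ ≤ M ∧ |Δ φ x| ≤ M := by
  obtain ⟨A, hA⟩ := hφ.continuous.bounded_above_of_compact_support hc
  obtain ⟨B, hB⟩ := (hφ.continuous_fderiv (by simp)).bounded_above_of_compact_support
    (hc.fderiv ℝ)
  obtain ⟨C, hC⟩ := (contDiff_laplacian hφ).continuous.bounded_above_of_compact_support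
    (hasCompactSupport_laplacian hc)
  refine ⟨max A (max B C), (norm_nonneg _).trans ((hA 0).trans (le_max_left _ _)), fun x =>
    ⟨(hA x).trans (le_max_left _ _), (hB x).trans ?_, (hC x).trans ?_⟩⟩
  · exact (le_max_left _ _).trans (le_max_right _ _)
  · exact (le_max_right _ _).trans (le_max_right _ _)

/-- A smooth bump function equal to one on the ball of radius `1 / 2` and supported in the unit
ball. -/
noncomputable def unitBump : ContDiffBump (0 : E4) := ⟨1 / 2, 1, by norm_num, by norm_num⟩

/-- The bump function `unitBump` rescaled to the ball of radius `r`. -/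
noncomputable def cutoff (r : ℝ) (x : E4) : ℝ := unitBump (r⁻¹ • x)

section Cutoff

variable {r : ℝ} {x : E4}

lemma contDiff_cutoff (r : ℝ) : ContDiff ℝ ∞ (cutoff r) :=
  unitBump.contDiff.comp (contDiff_const_smul _)

lemma cutoff_nonneg (r : ℝ) (x : E4) : 0 ≤ cutoff r x := unitBump.nonneg

lemma cutoff_le_one (r : ℝ) (x : E4) : cutoff r x ≤ 1 := unitBump.le_one

lemma cutoff_eq_one (hr : 0 < r) (hx : ‖x‖ ≤ r / 2) : cutoff r x = 1 := by
  refine unitBump.one_of_mem_closedBall ?_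
  rw [mem_closedBall_zero_iff, norm_smul, norm_inv, Real.norm_of_nonneg hr.le]
  change _ ≤ (1 : ℝ) / 2
  rw [inv_mul_le_iff₀ hr]
  linarith

lemma cutoff_eventuallyEq_one (hr : 0 < r) (hx : ‖x‖ < r / 2) :
    cutoff r =ᶠ[𝓝 x] fun _ => 1 := by
  filter_upwards [continuous_norm.continuousAt.eventually_lt_const hx] with y hy
    using cutoff_eq_one hr hy.le

lemma tsupport_cutoff_subset (hr : 0 < r) : tsupport (cutoff r) ⊆ Metric.closedBall 0 r := by
  refine closure_minimal (fun x hx => ?_) Metric.isClosed_closedBall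
  by_contra h
  rw [mem_closedBall_zero_iff, not_le] at h
  refine hx (unitBump.zero_of_le_dist ?_)
  rw [dist_zero_right, norm_smul, norm_inv, Real.norm_of_nonneg hr.le]
  change (1 : ℝ) ≤ _
  rw [le_inv_mul_iff₀ hr]
  linarith

lemma hasCompactSupport_cutoff (hr : 0 < r) : HasCompactSupport (cutoff r) :=
  (isCompact_closedBall (0 : E4) r).of_isClosed_subset (isClosed_tsupport _)
    (tsupport_cutoff_subset hr)

lemma cutoff_eventuallyEq_zero (hr : 0 < r) (hx : r < ‖x‖) : cutoff r =ᶠ[𝓝 x] fun _ => 0 := by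
  refine notMem_tsupport_iff_eventuallyEq.1 fun h => ?_
  have := tsupport_cutoff_subset hr h
  rw [mem_closedBall_zero_iff] at this
  linarith

lemma exists_cutoff_bound : ∃ M : ℝ, 0 ≤ M ∧ ∀ r : ℝ, 0 < r → ∀ x,
    ‖fderiv ℝ (cutoff r) x‖ ≤ M * r⁻¹ ∧ |Δ (cutoff r) x| ≤ M * r⁻¹ ^ 2 := by
  obtain ⟨M, hM, h⟩ := exists_norm_fderiv_laplacian_le (φ := unitBump) unitBump.contDiff
    unitBump.hasCompactSupport
  refine ⟨M, hM, fun r hr x => ⟨?_, ?_⟩⟩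
  · have : fderiv ℝ (cutoff r) x = r⁻¹ • fderiv ℝ unitBump (r⁻¹ • x) := fderiv_comp_smul r⁻¹
    rw [this, norm_smul, Real.norm_of_nonneg (by positivity), mul_comm]
    exact mul_le_mul_of_nonneg_right (h _).2.1 (by positivity)
  · have : Δ (cutoff r) x = r⁻¹ ^ 2 * Δ (⇑unitBump) (r⁻¹ • x) := laplacian_comp_smul _ _ _
    rw [this, abs_mul, abs_of_nonneg (by positivity), mul_comm]
    exact mul_le_mul_of_nonneg_right (h _).2.2 (by positivity)

/-- The closed annulus outside of which `cutoff r` is locally constant. -/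
def cutoffAnnulus (r : ℝ) : Set E4 := Metric.closedBall 0 r \ Metric.ball 0 (r / 2)

lemma isCompact_cutoffAnnulus (r : ℝ) : IsCompact (cutoffAnnulus r) :=
  (isCompact_closedBall _ _).diff Metric.isOpen_ball

lemma cutoff_eventuallyEq_const (hr : 0 < r) (hx : x ∉ cutoffAnnulus r) :
    ∃ c, cutoff r =ᶠ[𝓝 x] fun _ => c := by
  rw [cutoffAnnulus, Set.mem_sdiff, not_and_or, not_not, mem_closedBall_zero_iff,
    mem_ball_zero_iff, not_le] at hx
  exact hx.elim (fun h => ⟨0, cutoff_eventuallyEq_zero hr h⟩)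
    fun h => ⟨1, cutoff_eventuallyEq_one hr h⟩

/-- Derivatives of the cutoff live on an annulus at distance at least `r/2` from `0`, where the
barrier and its gradient are bounded independently of `δ` and `ε`. This uniformity permits `ε → 0`
in the tested equation. -/
lemma exists_cutoff_barrier_bound (hr : 0 < r) : ∃ K : ℝ, 0 ≤ K ∧
    ∀ δ ε : ℝ, 0 ≤ δ → δ ≤ 1 → 0 < ε → ε ≤ 1 → ∀ x,
      |2 * gradDot (cutoff r) (barrier δ ε) x| ≤ (cutoffAnnulus r).indicator (fun _ => K) x ∧
      |barrier δ ε x * Δ (cutoff r) x| ≤ (cutoffAnnulus r).indicator (fun _ => K) x := by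
  obtain ⟨M, hM, h⟩ := exists_norm_fderiv_laplacian_le (contDiff_cutoff r)
    (hasCompactSupport_cutoff hr)
  refine ⟨max (2 * (4 * (M * (1 + 2 * ((r / 2) ^ 3)⁻¹)))) ((1 + r) * M),
    le_max_of_le_right (by positivity), fun δ ε hδ hδ1 hε hε1 x => ?_⟩
  by_cases hx : x ∈ cutoffAnnulus r
  · rw [indicator_of_mem hx]
    obtain ⟨hx1, hx2⟩ := hx
    rw [mem_closedBall_zero_iff] at hx1
    rw [mem_ball_zero_iff, not_lt] at hx2
    have hn : 0 < ‖x‖ := by linarith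
    constructor
    · refine le_trans ?_ (le_max_left _ _)
      rw [abs_mul, abs_two]
      refine mul_le_mul_of_nonneg_left ((abs_gradDot_le _ _ _).trans ?_) two_pos.le
      refine mul_le_mul_of_nonneg_left (mul_le_mul (h x).2.1 ?_ (norm_nonneg _) hM) (by norm_num)
      refine (norm_fderiv_barrier_le hδ ε (norm_pos_iff.1 hn)).trans ?_
      have h1 : (‖x‖ ^ 3)⁻¹ ≤ ((r / 2) ^ 3)⁻¹ := by gcongr
      have h2 : ε ^ 2 ≤ 1 := pow_le_one₀ hε.le hε1
      have h3 : 0 ≤ (‖x‖ ^ 3)⁻¹ := by positivity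
      nlinarith
    · refine le_trans ?_ (le_max_right _ _)
      rw [abs_mul, abs_of_nonneg (barrier_nonneg _ _ _)]
      refine mul_le_mul ((barrier_le hδ ε x).trans ?_) (h x).2.2 (abs_nonneg _) (by positivity)
      nlinarith
  · rw [indicator_of_notMem hx]
    obtain ⟨c, hc⟩ := cutoff_eventuallyEq_const hr hx
    have h1 : fderiv ℝ (cutoff r) x = 0 := by rw [hc.fderiv_eq]; simp
    rw [laplacian_eq_zero_of_eventuallyEq_const hc]
    simp [gradDot, h1]

end Cutoff

/-! ### Local integrability across the puncture -/

section Integrability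

variable {U Ω : Opens E4} {w : E4 → ℝ}

lemma MeasureTheory.LocallyIntegrableOn.integrableOn_mul_of_tsupport_subset
    (hw : LocallyIntegrableOn w (U : Set E4)) {ψ : E4 → ℝ} (hψ : Continuous ψ)
    (hc : HasCompactSupport ψ) (hs : tsupport ψ ⊆ U) :
    IntegrableOn (fun x => w x * ψ x) (U : Set E4) := by
  have h1 : IntegrableOn w (tsupport ψ) := hw.integrableOn_compact_subset hs hc
  have h2 : IntegrableOn (fun x => w x * ψ x) (tsupport ψ) :=
    h1.mul_continuousOn hψ.continuousOn hc
  refine h2.of_forall_sdiff_eq_zero U.isOpen.measurableSet fun x hx => ?_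
  rw [image_eq_zero_of_notMem_tsupport hx.2, mul_zero]

lemma restrict_punctured (Ω : Opens E4) :
    volume.restrict (punctured Ω : Set E4) = volume.restrict (Ω : Set E4) :=
  Measure.restrict_congr_set (sdiff_null_ae_eq_self (by simp))

lemma locallyIntegrableOn_of_punctured (hw : LocallyIntegrableOn w (punctured Ω : Set E4))
    {r : ℝ} (hr : 0 < r) (hi : IntegrableOn w (Metric.ball 0 r)) :
    LocallyIntegrableOn w (Ω : Set E4) := by
  intro x hx
  by_cases h : x = 0
  · subst h
    exact ⟨_, mem_nhdsWithin_of_mem_nhds (Metric.ball_mem_nhds _ hr), hi⟩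
  · have h1 := hw x ⟨hx, h⟩
    rw [(punctured Ω).isOpen.nhdsWithin_eq ⟨hx, h⟩] at h1
    exact h1.filter_mono nhdsWithin_le_nhds

lemma tendsto_div_nat_succ (r : ℝ) : Tendsto (fun n : ℕ => r / ((n : ℝ) + 1)) atTop (𝓝 0) := by
  simpa [div_eq_mul_inv] using tendsto_one_div_add_atTop_nhds_zero_nat (𝕜 := ℝ) |>.const_mul r

lemma tendsto_setIntegral_closedBall {H : E4 → ℝ} {r : ℝ}
    (hH : IntegrableOn H (Metric.closedBall 0 r)) (hr : 0 < r) :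
    Tendsto (fun n : ℕ => ∫ x in Metric.closedBall (0 : E4) (r / (n + 1)), H x) atTop (𝓝 0) := by
  have hanti : Antitone fun n : ℕ => Metric.closedBall (0 : E4) (r / (n + 1)) := fun m n hmn =>
    Metric.closedBall_subset_closedBall (by gcongr)
  have h := tendsto_setIntegral_of_antitone (f := H) (μ := volume)
    (fun n : ℕ => Metric.isClosed_closedBall.measurableSet) hanti
    ⟨0, by simpa using hH⟩
  have hz : ⋂ n : ℕ, Metric.closedBall (0 : E4) (r / (n + 1)) = {0} := by
    ext x
    simp only [mem_iInter, mem_closedBall_zero_iff, mem_singleton_iff]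
    constructor
    · intro hx
      exact norm_le_zero_iff.1 (ge_of_tendsto' (tendsto_div_nat_succ r) hx)
    · rintro rfl n
      rw [norm_zero]
      positivity
  rw [hz] at h
  simpa using h

end Integrability


/-! ### Barrier estimates for punctured supersolutions -/

/-- `w, g ≥ 0` are locally integrable on `Ω \ {0}` and `-Δ w = g` there in the sense of
distributions. -/
structure IsPuncturedSupersolution (Ω : Opens E4) (w g : E4 → ℝ) : Prop where
  left : LocallyIntegrableOn w (punctured Ω : Set E4)
  right : LocallyIntegrableOn g (punctured Ω : Set E4)
  left_nonneg : ∀ᵐ x ∂(volume.restrict (punctured Ω : Set E4)), 0 ≤ w x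
  right_nonneg : ∀ᵐ x ∂(volume.restrict (punctured Ω : Set E4)), 0 ≤ g x
  integral_eq_zero : ∀ φ : E4 → ℝ, ContDiff ℝ ∞ φ → HasCompactSupport φ →
    tsupport φ ⊆ punctured Ω → ∫ x in (punctured Ω : Set E4), (w x * Δ φ x + g x * φ x) = 0

lemma contDiffAt_two {φ : E4 → ℝ} (hφ : ContDiff ℝ ∞ φ) (x : E4) : ContDiffAt ℝ 2 φ x :=
  (contDiff_infty.1 hφ 2).contDiffAt

lemma tsupport_subset_punctured {Ω : Opens E4} {φ : E4 → ℝ} (hs : tsupport φ ⊆ Ω)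
    (h0 : φ =ᶠ[𝓝 0] fun _ => 0) : tsupport φ ⊆ punctured Ω := fun _ hx =>
  ⟨hs hx, fun h => notMem_tsupport_iff_eventuallyEq.2 h0 (mem_singleton_iff.1 h ▸ hx)⟩

lemma tsupport_mul_subset_punctured {Ω : Opens E4} {φ q : E4 → ℝ} (hs : tsupport φ ⊆ Ω)
    (h0 : q =ᶠ[𝓝 0] fun _ => 0) : tsupport (fun x => φ x * q x) ⊆ punctured Ω := by
  refine tsupport_subset_punctured ((tsupport_mul_subset_left (f := φ) (g := q)).trans hs) ?_
  filter_upwards [h0] with x hx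
  rw [hx, mul_zero]

namespace IsPuncturedSupersolution

variable {Ω : Opens E4} {w g : E4 → ℝ} {R : ℝ}

lemma integrableOn_indicator (h : IsPuncturedSupersolution Ω w g) (hR : 0 < R)
    (hRΩ : Metric.closedBall (0 : E4) R ⊆ Ω) (K : ℝ) :
    IntegrableOn (fun x => w x * (cutoffAnnulus R).indicator (fun _ => K) x)
      (punctured Ω : Set E4) := by
  have hA : cutoffAnnulus R ⊆ (punctured Ω : Set E4) := by
    intro x hx
    refine ⟨hRΩ hx.1, fun h0 => hx.2 ?_⟩
    rw [mem_singleton_iff.1 h0]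
    exact Metric.mem_ball_self (half_pos hR)
  have h1 : IntegrableOn (fun x => w x * K) (cutoffAnnulus R) :=
    (h.left.integrableOn_compact_subset hA (isCompact_cutoffAnnulus R)).mul_const K
  have h2 := (h1.integrable_indicator (isCompact_cutoffAnnulus R).isClosed.measurableSet)
  refine (h2.integrableOn (s := (punctured Ω : Set E4))).congr (Eventually.of_forall fun x => ?_)
  by_cases hx : x ∈ cutoffAnnulus R <;> simp [hx]

lemma integrableOn_laplacian_add (h : IsPuncturedSupersolution Ω w g) {φ q : E4 → ℝ}
    (hφ : ContDiff ℝ ∞ φ) (hc : HasCompactSupport φ) (hs : tsupport φ ⊆ Ω)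
    (hq : ContDiff ℝ ∞ q) (h0 : q =ᶠ[𝓝 0] fun _ => 0) :
    IntegrableOn (fun x => φ x * (w x * Δ q x + g x * q x)) (punctured Ω : Set E4) := by
  have h0' : Δ q =ᶠ[𝓝 0] fun _ => 0 := by
    filter_upwards [h0.eventuallyEq_nhds] with y hy
    exact laplacian_eq_zero_of_eventuallyEq_const hy
  have h1 := h.left.integrableOn_mul_of_tsupport_subset (ψ := fun x => φ x * Δ q x)
    (hφ.continuous.mul (contDiff_laplacian hq).continuous) hc.mul_right
    (tsupport_mul_subset_punctured hs h0')
  have h2 := h.right.integrableOn_mul_of_tsupport_subset (ψ := fun x => φ x * q x)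
    (hφ.continuous.mul hq.continuous) hc.mul_right (tsupport_mul_subset_punctured hs h0)
  exact (h1.add h2).congr (Eventually.of_forall fun x => by simp only [Pi.add_apply]; ring)

/-- The weak equation tested with `cutoff R * q`, expanded by the product rule. -/
lemma integral_cutoff_mul_eq_zero (h : IsPuncturedSupersolution Ω w g) (hR : 0 < R)
    (hRΩ : Metric.closedBall (0 : E4) R ⊆ Ω) {q : E4 → ℝ}
    (hq : ContDiff ℝ ∞ q) (h0 : q =ᶠ[𝓝 0] fun _ => 0) :
    ∫ x in (punctured Ω : Set E4), (cutoff R x * (w x * Δ q x + g x * q x) +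
      (w x * (2 * gradDot (cutoff R) q x) + w x * (q x * Δ (cutoff R) x))) = 0 := by
  rw [← h.integral_eq_zero (fun x => cutoff R x * q x) ((contDiff_cutoff R).mul hq)
    (hasCompactSupport_cutoff hR).mul_right
    (tsupport_mul_subset_punctured ((tsupport_cutoff_subset hR).trans hRΩ) h0)]
  refine integral_congr_ae (Eventually.of_forall fun x => ?_)
  simp only
  rw [laplacian_mul (contDiffAt_two (contDiff_cutoff R) x) (contDiffAt_two hq x)]
  ring

lemma continuous_gradDot {f q : E4 → ℝ} (hf : ContDiff ℝ ∞ f) (hq : ContDiff ℝ ∞ q) :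
    Continuous (gradDot f q) :=
  continuous_finsetSum _ fun _ _ =>
    ((hf.continuous_fderiv (by simp)).clm_apply continuous_const).mul
      ((hq.continuous_fderiv (by simp)).clm_apply continuous_const)

lemma abs_mul_le_mul_indicator {x : E4} {s t K : ℝ} {A : Set E4} (hs : 0 ≤ s)
    (ht : |t| ≤ A.indicator (fun _ => K) x) : ‖s * t‖ ≤ s * A.indicator (fun _ => K) x := by
  rw [Real.norm_eq_abs, abs_mul, abs_of_nonneg hs]
  exact mul_le_mul_of_nonneg_left ht hs

/-- In the tested equation, the terms carrying derivatives of the cutoff are bounded by the integral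
of `w` over the annulus, a compact subset of the punctured domain. The remaining term is therefore
bounded uniformly in `δ` and `ε`. -/
lemma exists_integral_cutoff_barrier_le (h : IsPuncturedSupersolution Ω w g) (hR : 0 < R)
    (hRΩ : Metric.closedBall (0 : E4) R ⊆ Ω) :
    ∃ C : ℝ, ∀ δ ε : ℝ, 0 ≤ δ → δ ≤ 1 → 0 < ε → ε ≤ 1 →
      ∫ x in (punctured Ω : Set E4),
        cutoff R x * (w x * Δ (barrier δ ε) x + g x * barrier δ ε x) ≤ C := by
  obtain ⟨K, hK, hb⟩ := exists_cutoff_barrier_bound hR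
  refine ⟨2 * ∫ x in (punctured Ω : Set E4), w x * (cutoffAnnulus R).indicator (fun _ => K) x,
    fun δ ε hδ hδ1 hε hε1 => ?_⟩
  have hq := contDiff_barrier hδ1 hε hε1
  have h0 := barrier_eventuallyEq_zero hδ1 hε hε1
  have hi := h.integrableOn_indicator hR hRΩ K
  have hm := h.left.aestronglyMeasurable
  have hi1 : IntegrableOn (fun x => w x * (2 * gradDot (cutoff R) (barrier δ ε) x))
      (punctured Ω : Set E4) := by
    refine Integrable.mono' hi (hm.mul (continuous_const.mul
      (continuous_gradDot (contDiff_cutoff R) hq)).aestronglyMeasurable) ?_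
    filter_upwards [h.left_nonneg] with x hx
      using abs_mul_le_mul_indicator hx (hb δ ε hδ hδ1 hε hε1 x).1
  have hi2 : IntegrableOn (fun x => w x * (barrier δ ε x * Δ (cutoff R) x))
      (punctured Ω : Set E4) := by
    refine Integrable.mono' hi (hm.mul (hq.continuous.mul
      (contDiff_laplacian (contDiff_cutoff R)).continuous).aestronglyMeasurable) ?_
    filter_upwards [h.left_nonneg] with x hx
      using abs_mul_le_mul_indicator hx (hb δ ε hδ hδ1 hε hε1 x).2
  have hi12 : IntegrableOn (fun x => w x * (2 * gradDot (cutoff R) (barrier δ ε) x) +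
      w x * (barrier δ ε x * Δ (cutoff R) x)) (punctured Ω : Set E4) := hi1.add hi2
  have he := h.integral_cutoff_mul_eq_zero hR hRΩ hq h0
  rw [integral_add (h.integrableOn_laplacian_add (contDiff_cutoff R) (hasCompactSupport_cutoff hR)
    ((tsupport_cutoff_subset hR).trans hRΩ) hq h0) hi12, integral_add hi1 hi2] at he
  have b1 := norm_integral_le_of_norm_le hi (by
    filter_upwards [h.left_nonneg] with x hx
      using abs_mul_le_mul_indicator hx (hb δ ε hδ hδ1 hε hε1 x).1)
  have b2 := norm_integral_le_of_norm_le hi (by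
    filter_upwards [h.left_nonneg] with x hx
      using abs_mul_le_mul_indicator hx (hb δ ε hδ hδ1 hε hε1 x).2)
  rw [Real.norm_eq_abs] at b1 b2
  linarith [(abs_le.1 b1).1, (abs_le.1 b2).1]

/-- The weighted integrability `w / |x|, g ∈ L¹` near the origin. -/
lemma integrableOn_ball (h : IsPuncturedSupersolution Ω w g) (hR : 0 < R)
    (hRΩ : Metric.closedBall (0 : E4) R ⊆ Ω) :
    IntegrableOn (fun x => w x / ‖x‖) (Metric.ball 0 (R / 2)) ∧
      IntegrableOn g (Metric.ball 0 (R / 2)) := by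
  obtain ⟨C, hC⟩ := h.exists_integral_cutoff_barrier_le hR hRΩ
  set B : Set E4 := Metric.ball 0 (R / 2) \ {0} with hB
  have hBm : MeasurableSet B := Metric.isOpen_ball.measurableSet.diff (measurableSet_singleton 0)
  have hBΩ : B ⊆ (punctured Ω : Set E4) := fun x hx =>
    ⟨hRΩ (Metric.ball_subset_closedBall (Metric.ball_subset_ball (by linarith) hx.1)), hx.2⟩
  have hBae : volume.restrict B = volume.restrict (Metric.ball (0 : E4) (R / 2)) :=
    Measure.restrict_congr_set (sdiff_null_ae_eq_self (by simp))
  have hwm : AEStronglyMeasurable w (volume.restrict B) :=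
    h.left.aestronglyMeasurable.mono_measure (Measure.restrict_mono_set _ hBΩ)
  have hgm : AEStronglyMeasurable g (volume.restrict B) :=
    h.right.aestronglyMeasurable.mono_measure (Measure.restrict_mono_set _ hBΩ)
  have hwdm : AEStronglyMeasurable (fun x => w x / ‖x‖) (volume.restrict B) :=
    (hwm.aemeasurable.div measurable_norm.aemeasurable).aestronglyMeasurable
  have hw0 : ∀ᵐ x ∂(volume.restrict B), 0 ≤ w x :=
    ae_mono (Measure.restrict_mono_set _ hBΩ) h.left_nonneg
  have hg0 : ∀ᵐ x ∂(volume.restrict B), 0 ≤ g x :=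
    ae_mono (Measure.restrict_mono_set _ hBΩ) h.right_nonneg
  have hxB : ∀ᵐ x ∂(volume.restrict B), x ∈ B := ae_restrict_mem hBm
  set H : E4 → ℝ := fun x => 3 * (w x / ‖x‖) + smoothRamp 1 * g x with hH
  have hHm : AEStronglyMeasurable H (volume.restrict B) := (hwdm.const_mul 3).add (hgm.const_mul _)
  set ε : ℕ → ℝ := fun n => 1 / ((n : ℝ) + 1) with hε
  have hεpos : ∀ n, 0 < ε n := fun n => by positivity
  have hεle : ∀ n, ε n ≤ 1 := fun n => by
    rw [hε]
    exact div_le_one_of_le₀ (by linarith [n.cast_nonneg (α := ℝ)]) (by positivity)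
  -- The region where the lower bounds on the barrier and its Laplacian hold with `δ = 1`. These
  -- sets cover almost every point of `B` eventually, so a uniform bound for the integrals of `H`
  -- over them yields integrability on `B`.
  set S : ℕ → Set E4 := fun n => {x | ε n ^ 2 ≤ 1 * ‖x‖ ^ 3} with hS
  have hSm : ∀ n, MeasurableSet (S n) := fun n =>
    measurableSet_le measurable_const ((measurable_norm.pow_const 3).const_mul 1)
  have hcover : AECover (volume.restrict B) atTop S := by
    refine ⟨?_, hSm⟩
    filter_upwards [hxB] with x hx
    have h1 : Tendsto (fun n => ε n ^ 2) atTop (𝓝 0) := by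
      have := (tendsto_div_nat_succ 1).pow 2
      rwa [zero_pow two_ne_zero] at this
    have hx0 : 0 < ‖x‖ := norm_pos_iff.2 hx.2
    exact (h1.eventually_lt_const (show (0 : ℝ) < 1 * ‖x‖ ^ 3 by positivity)).mono
      fun n hn => hn.le
  set k : ℕ → E4 → ℝ := fun n x =>
    cutoff R x * (w x * Δ (barrier 1 (ε n)) x + g x * barrier 1 (ε n) x) with hk
  have hki : ∀ n, IntegrableOn (k n) (punctured Ω : Set E4) := fun n =>
    h.integrableOn_laplacian_add (contDiff_cutoff R) (hasCompactSupport_cutoff hR)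
      ((tsupport_cutoff_subset hR).trans hRΩ) (contDiff_barrier le_rfl (hεpos n) (hεle n))
      (barrier_eventuallyEq_zero le_rfl (hεpos n) (hεle n))
  have hk0 : ∀ n, ∀ᵐ x ∂(volume.restrict (punctured Ω : Set E4)), 0 ≤ k n x := fun n => by
    filter_upwards [h.left_nonneg, h.right_nonneg,
      ae_restrict_mem (punctured Ω).isOpen.measurableSet] with x hw hg hx
    exact mul_nonneg (cutoff_nonneg _ _) (add_nonneg
      (mul_nonneg hw (laplacian_barrier_nonneg zero_le_one _ hx.2))
      (mul_nonneg hg (barrier_nonneg _ _ _)))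
  have hH0 : ∀ᵐ x ∂(volume.restrict B), 0 ≤ H x := by
    filter_upwards [hw0, hg0] with x hw hg
    have := smoothRamp_one_pos
    positivity
  have hHk : ∀ n, ∀ᵐ x ∂((volume.restrict B).restrict (S n)), H x ≤ k n x := fun n => by
    filter_upwards [ae_restrict_of_ae hw0, ae_restrict_of_ae hg0, ae_restrict_of_ae hxB,
      ae_restrict_mem (hSm n)] with x hw hg hx hxS
    have h1 := le_laplacian_barrier hx.2 hxS
    have h2 := le_barrier hx.2 hxS
    rw [hk]
    simp only
    rw [cutoff_eq_one hR (mem_ball_zero_iff.1 hx.1).le, one_mul, hH]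
    refine add_le_add ?_ ?_
    · calc 3 * (w x / ‖x‖) = w x * (3 * 1 / ‖x‖) := by ring
        _ ≤ _ := mul_le_mul_of_nonneg_left h1 hw
    · rw [mul_comm]
      exact mul_le_mul_of_nonneg_left h2 hg
  have hkB : ∀ n, IntegrableOn (k n) (S n) (volume.restrict B) := fun n =>
    ((hki n).mono_set hBΩ).integrableOn
  have hHS : ∀ n, IntegrableOn H (S n) (volume.restrict B) := fun n => by
    refine Integrable.mono' (hkB n) hHm.restrict ?_
    filter_upwards [hHk n, ae_restrict_of_ae hH0] with x hx hx0
    rwa [Real.norm_of_nonneg hx0]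
  have hHint : Integrable H (volume.restrict B) := by
    refine hcover.integrable_of_integral_bounded_of_nonneg_ae C hHS hH0
      (Eventually.of_forall fun n => ?_)
    calc ∫ x in S n, H x ∂(volume.restrict B) ≤ ∫ x in S n, k n x ∂(volume.restrict B) :=
          integral_mono_ae (hHS n) (hkB n) (hHk n)
      _ ≤ ∫ x in (punctured Ω : Set E4), k n x := by
          rw [Measure.restrict_restrict (hSm n)]
          exact setIntegral_mono_set (hki n) (hk0 n)
            (inter_subset_right.trans hBΩ).eventuallyLE
      _ ≤ C := hC 1 (ε n) zero_le_one le_rfl (hεpos n) (hεle n)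
  rw [IntegrableOn, IntegrableOn, ← hBae]
  constructor
  · refine Integrable.mono' hHint hwdm ?_
    filter_upwards [hw0, hg0] with x hw hg
    have h1 : 0 ≤ w x / ‖x‖ := by positivity
    have h2 : 0 ≤ smoothRamp 1 * g x := mul_nonneg smoothRamp_one_pos.le hg
    rw [Real.norm_of_nonneg h1, hH]
    simp only
    linarith
  · refine Integrable.mono' (hHint.const_mul (smoothRamp 1)⁻¹) hgm ?_
    filter_upwards [hw0, hg0] with x hw hg
    have h1 : 0 ≤ w x / ‖x‖ := by positivity
    rw [Real.norm_of_nonneg hg, hH, le_inv_mul_iff₀ smoothRamp_one_pos]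
    linarith

end IsPuncturedSupersolution


/-! ### The distribution `Δ w + g` on the whole domain -/

/-- The unbundled form of `φ ∈ 𝓓(Ω)`. -/
structure IsTestFunction (Ω : Opens E4) (φ : E4 → ℝ) : Prop where
  contDiff : ContDiff ℝ ∞ φ
  hasCompactSupport : HasCompactSupport φ
  tsupport_subset : tsupport φ ⊆ Ω

/-- The value `⟨Δ w + g, φ⟩` for locally integrable `w` and `g`. -/
noncomputable def laplacianPairing (Ω : Opens E4) (w g φ : E4 → ℝ) : ℝ :=
  ∫ x in (Ω : Set E4), (w x * Δ φ x + g x * φ x)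

section Pairing

variable {Ω : Opens E4} {w g φ ψ : E4 → ℝ} {R : ℝ}

lemma IsTestFunction.sub (hφ : IsTestFunction Ω φ) (hψ : IsTestFunction Ω ψ) :
    IsTestFunction Ω (φ - ψ) :=
  ⟨hφ.contDiff.sub hψ.contDiff, hφ.hasCompactSupport.sub hψ.hasCompactSupport,
    (tsupport_sub φ ψ).trans (union_subset hφ.tsupport_subset hψ.tsupport_subset)⟩

lemma IsTestFunction.mul_left (hφ : IsTestFunction Ω φ) (hψ : ContDiff ℝ ∞ ψ) :
    IsTestFunction Ω (fun x => ψ x * φ x) :=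
  ⟨hψ.mul hφ.contDiff, hφ.hasCompactSupport.mul_left,
    (tsupport_mul_subset_right (f := ψ) (g := φ)).trans hφ.tsupport_subset⟩

lemma isTestFunction_cutoff (hR : 0 < R) (hRΩ : Metric.closedBall (0 : E4) R ⊆ Ω) :
    IsTestFunction Ω (cutoff R) :=
  ⟨contDiff_cutoff R, hasCompactSupport_cutoff hR, (tsupport_cutoff_subset hR).trans hRΩ⟩

lemma integrableOn_laplacianPairing (hw : LocallyIntegrableOn w (Ω : Set E4))
    (hg : LocallyIntegrableOn g (Ω : Set E4)) (hφ : IsTestFunction Ω φ) :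
    IntegrableOn (fun x => w x * Δ φ x + g x * φ x) (Ω : Set E4) :=
  (hw.integrableOn_mul_of_tsupport_subset (contDiff_laplacian hφ.contDiff).continuous
    (hasCompactSupport_laplacian hφ.hasCompactSupport)
    ((tsupport_laplacian_subset φ).trans hφ.tsupport_subset)).add
  (hg.integrableOn_mul_of_tsupport_subset hφ.contDiff.continuous hφ.hasCompactSupport
    hφ.tsupport_subset)

lemma laplacianPairing_sub (hw : LocallyIntegrableOn w (Ω : Set E4))
    (hg : LocallyIntegrableOn g (Ω : Set E4)) (hφ : IsTestFunction Ω φ)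
    (hψ : IsTestFunction Ω ψ) :
    laplacianPairing Ω w g (φ - ψ) = laplacianPairing Ω w g φ - laplacianPairing Ω w g ψ := by
  rw [laplacianPairing, laplacianPairing, laplacianPairing,
    ← integral_sub (integrableOn_laplacianPairing hw hg hφ)
      (integrableOn_laplacianPairing hw hg hψ)]
  refine integral_congr_ae (Eventually.of_forall fun x => ?_)
  simp only [Pi.sub_apply]
  rw [(contDiffAt_two hφ.contDiff x).laplacian_sub (contDiffAt_two hψ.contDiff x)]
  ring

lemma laplacianPairing_const_mul (c : ℝ) (hφ : ContDiff ℝ ∞ φ) :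
    laplacianPairing Ω w g (fun x => c * φ x) = c * laplacianPairing Ω w g φ := by
  rw [laplacianPairing, laplacianPairing, ← integral_const_mul]
  refine integral_congr_ae (Eventually.of_forall fun x => ?_)
  have h : Δ (fun x => c * φ x) x = c * Δ φ x :=
    InnerProductSpace.laplacian_smul (𝕜 := ℝ) c (contDiffAt_two hφ x)
  simp only
  rw [h]
  ring

lemma abs_laplacianPairing_le {H : E4 → ℝ} (hRΩ : Metric.closedBall (0 : E4) R ⊆ Ω)
    (hH : IntegrableOn H (Metric.closedBall 0 R))
    (hb : ∀ᵐ x ∂(volume.restrict (Ω : Set E4)),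
      |w x * Δ φ x + g x * φ x| ≤ (Metric.closedBall 0 R).indicator H x) :
    |laplacianPairing Ω w g φ| ≤ ∫ x in Metric.closedBall 0 R, H x := by
  have hm : MeasurableSet (Metric.closedBall (0 : E4) R) := measurableSet_closedBall
  have h := norm_integral_le_of_norm_le (f := fun x => w x * Δ φ x + g x * φ x) (hH.integrable_indicator hm).integrableOn hb
  rwa [setIntegral_indicator hm, inter_eq_right.2 hRΩ] at h

lemma exists_closedBall_subset (h0 : (0 : E4) ∈ Ω) :
    ∃ R > 0, R ≤ 1 ∧ Metric.closedBall (0 : E4) R ⊆ Ω := by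
  obtain ⟨R, hR, h⟩ := Metric.nhds_basis_closedBall.mem_iff.1 (Ω.isOpen.mem_nhds h0)
  exact ⟨min R 1, lt_min hR one_pos, min_le_right _ _,
    (Metric.closedBall_subset_closedBall (min_le_left _ _)).trans h⟩

end Pairing

/-! ### The Brezis–Lions theorem and absence of a Dirac mass -/

namespace IsPuncturedSupersolution

variable {Ω : Opens E4} {w g φ ψ : E4 → ℝ} {R : ℝ}

lemma locallyIntegrableOn (h : IsPuncturedSupersolution Ω w g) (h0 : (0 : E4) ∈ Ω) :
    LocallyIntegrableOn w (Ω : Set E4) ∧ LocallyIntegrableOn g (Ω : Set E4) := by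
  obtain ⟨R, hR, -, hRΩ⟩ := exists_closedBall_subset h0
  obtain ⟨h1, h2⟩ := h.integrableOn_ball hR hRΩ
  refine ⟨locallyIntegrableOn_of_punctured h.left (half_pos hR) ?_,
    locallyIntegrableOn_of_punctured h.right (half_pos hR) h2⟩
  have h3 : IntegrableOn (fun x => ‖x‖ * (w x / ‖x‖)) (Metric.ball 0 (R / 2)) := by
    refine Integrable.mono' (h1.norm.const_mul (R / 2))
      (continuous_norm.aestronglyMeasurable.mul h1.aestronglyMeasurable) ?_
    filter_upwards [ae_restrict_mem measurableSet_ball] with x hx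
    rw [norm_mul, norm_norm]
    exact mul_le_mul_of_nonneg_right (mem_ball_zero_iff.1 hx).le (norm_nonneg _)
  refine h3.congr ?_
  filter_upwards [ae_restrict_of_ae (compl_mem_ae_iff.2 (measure_singleton (0 : E4)))] with x hx
  exact mul_div_cancel₀ _ (norm_ne_zero_iff.2 hx)

/-- The difference of the test functions vanishes near `0`, hence is admissible in the punctured
equation. Thus `Δ w + g` sees only the germ at the origin. -/
lemma laplacianPairing_eq_of_eventuallyEq (h : IsPuncturedSupersolution Ω w g)
    (h0 : (0 : E4) ∈ Ω) (hφ : IsTestFunction Ω φ) (hψ : IsTestFunction Ω ψ) (he : φ =ᶠ[𝓝 0] ψ) :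
    laplacianPairing Ω w g φ = laplacianPairing Ω w g ψ := by
  obtain ⟨hw, hg⟩ := h.locallyIntegrableOn h0
  rw [← sub_eq_zero, ← laplacianPairing_sub hw hg hφ hψ, laplacianPairing, ← restrict_punctured]
  have hs := hφ.sub hψ
  refine h.integral_eq_zero _ hs.contDiff hs.hasCompactSupport
    (tsupport_subset_punctured hs.tsupport_subset ?_)
  filter_upwards [he] with x hx
  rw [Pi.sub_apply, hx, sub_self]

/-- Only the germ of `ψ` matters, so `ψ` may be multiplied by a cutoff at scale `ε`. Since `|ψ| ≤
M|x|`, the Laplacian of the product is `O(1/|x|)` on the `ε`-ball. As `w/|x|` and `g` are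
integrable, the pairing is bounded by integrals over shrinking balls. -/
lemma laplacianPairing_eq_zero (h : IsPuncturedSupersolution Ω w g) (h0 : (0 : E4) ∈ Ω)
    (hψ : IsTestFunction Ω ψ) (hψ0 : ψ 0 = 0) : laplacianPairing Ω w g ψ = 0 := by
  obtain ⟨R, hR, hR1, hRΩ⟩ := exists_closedBall_subset h0
  obtain ⟨hw1, hg1⟩ := h.integrableOn_ball hR hRΩ
  obtain ⟨M, hM, hψM⟩ := exists_norm_fderiv_laplacian_le hψ.contDiff hψ.hasCompactSupport
  obtain ⟨N, hN, hηN⟩ := exists_cutoff_bound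
  have hlin : ∀ x, |ψ x| ≤ M * ‖x‖ := fun x => by
    have := Convex.norm_image_sub_le_of_norm_fderiv_le (f := ψ) (𝕜 := ℝ) (s := univ) (x := 0)
      (y := x) (fun y _ => hψ.contDiff.differentiable (by simp) y) (fun y _ => (hψM y).2.1)
      convex_univ (mem_univ _) (mem_univ _)
    simpa [hψ0] using this
  -- The three summands are the constants of `b1`, `b2` and `b3` below, one for each term of the
  -- product rule.
  set K : ℝ := M * N + 2 * (4 * (M * N)) + M with hK
  set r : ℝ := R / 4 with hr
  have hrpos : 0 < r := by positivity
  have hsub : Metric.closedBall (0 : E4) r ⊆ Metric.ball 0 (R / 2) :=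
    Metric.closedBall_subset_ball (by rw [hr]; linarith)
  set H : E4 → ℝ := fun x => K * (w x / ‖x‖) + M * g x with hH
  have hHi : IntegrableOn H (Metric.closedBall 0 r) :=
    ((hw1.mono_set hsub).const_mul K).add ((hg1.mono_set hsub).const_mul M)
  have key : ∀ n : ℕ, |laplacianPairing Ω w g ψ| ≤
      ∫ x in Metric.closedBall (0 : E4) (r / (n + 1)), H x := by
    intro n
    set ε : ℝ := r / (n + 1) with hε
    have hεpos : 0 < ε := by positivity
    have hεr : ε ≤ r := div_le_self hrpos.le (by linarith [n.cast_nonneg (α := ℝ)])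
    have hε1 : ε ≤ 1 := hεr.trans (by rw [hr]; linarith)
    have hεR : Metric.closedBall (0 : E4) ε ⊆ Metric.closedBall 0 R :=
      Metric.closedBall_subset_closedBall (hεr.trans (by rw [hr]; linarith))
    have hη := isTestFunction_cutoff hεpos (hεR.trans hRΩ)
    rw [h.laplacianPairing_eq_of_eventuallyEq h0 hψ (hη.mul_left hψ.contDiff) (by
      filter_upwards [cutoff_eventuallyEq_one (x := 0) hεpos (by rw [norm_zero]; positivity)]
        with x hx
      rw [hx, mul_one])]
    refine abs_laplacianPairing_le (hεR.trans hRΩ)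
      (hHi.mono_set (Metric.closedBall_subset_closedBall hεr)) ?_
    rw [← restrict_punctured]
    filter_upwards [h.left_nonneg, h.right_nonneg,
      ae_restrict_mem (punctured Ω).isOpen.measurableSet] with x hwx hgx hx
    have hx0 : 0 < ‖x‖ := norm_pos_iff.2 hx.2
    by_cases hxε : ‖x‖ ≤ ε
    · rw [indicator_of_mem (mem_closedBall_zero_iff.2 hxε)]
      have hinv : ε⁻¹ ≤ ‖x‖⁻¹ := inv_anti₀ hx0 hxε
      have hinv1 : 1 ≤ ‖x‖⁻¹ := (one_le_inv₀ hx0).2 (hxε.trans hε1)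
      have b1 : |ψ x * Δ (cutoff ε) x| ≤ M * N * ‖x‖⁻¹ := by
        rw [abs_mul]
        calc |ψ x| * |Δ (cutoff ε) x| ≤ (M * ‖x‖) * (N * ‖x‖⁻¹ ^ 2) := by
              refine mul_le_mul (hlin x) ((hηN ε hεpos x).2.trans ?_) (abs_nonneg _)
                (by positivity)
              gcongr
          _ = _ := by field_simp
      have b2 : |2 * gradDot ψ (cutoff ε) x| ≤ 2 * (4 * (M * N)) * ‖x‖⁻¹ := by
        rw [abs_mul, abs_two, mul_assoc 2, mul_assoc 4, mul_assoc M]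
        refine mul_le_mul_of_nonneg_left ((abs_gradDot_le _ _ _).trans
          (mul_le_mul_of_nonneg_left ?_ (by norm_num))) two_pos.le
        refine mul_le_mul (hψM x).2.1 ((hηN ε hεpos x).1.trans ?_) (norm_nonneg _) hM
        exact mul_le_mul_of_nonneg_left hinv hN
      have b3 : |cutoff ε x * Δ ψ x| ≤ M * ‖x‖⁻¹ := by
        rw [abs_mul, abs_of_nonneg (cutoff_nonneg _ _)]
        calc cutoff ε x * |Δ ψ x| ≤ 1 * M :=
              mul_le_mul (cutoff_le_one _ _) (hψM x).2.2 (abs_nonneg _) zero_le_one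
          _ ≤ M * ‖x‖⁻¹ := by nlinarith
      have b4 : |ψ x * cutoff ε x| ≤ M := by
        rw [abs_mul, abs_of_nonneg (cutoff_nonneg _ _)]
        calc |ψ x| * cutoff ε x ≤ M * 1 :=
              mul_le_mul (hψM x).1 (cutoff_le_one _ _) (cutoff_nonneg _ _) hM
          _ = M := mul_one M
      rw [laplacian_mul (contDiffAt_two hψ.contDiff x) (contDiffAt_two (contDiff_cutoff ε) x)]
      refine (abs_add_le _ _).trans (add_le_add ?_ ?_)
      · rw [abs_mul, abs_of_nonneg hwx]
        calc _ ≤ w x * (K * ‖x‖⁻¹) := by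
              refine mul_le_mul_of_nonneg_left ?_ hwx
              refine (abs_add_le _ _).trans ((add_le_add_left (abs_add_le _ _) _).trans ?_)
              rw [hK]
              linarith
          _ = _ := by ring
      · rw [abs_mul, abs_of_nonneg hgx, mul_comm]
        exact mul_le_mul_of_nonneg_right b4 hgx
    · have hz := cutoff_eventuallyEq_zero hεpos (not_le.1 hxε)
      have hz' : (fun y => ψ y * cutoff ε y) =ᶠ[𝓝 x] fun _ => 0 := by
        filter_upwards [hz] with y hy
        rw [hy, mul_zero]
      rw [indicator_of_notMem (by rwa [mem_closedBall_zero_iff]),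
        laplacian_eq_zero_of_eventuallyEq_const hz', hz.eq_of_nhds]
      simp
  have := ge_of_tendsto' (tendsto_setIntegral_closedBall hHi hrpos) key
  exact abs_nonpos_iff.1 this

/-- Test with the cutoff times the barrier for `δ = 0` and drop the nonnegative term containing the
Laplacian of the barrier. As `ε → 0` the barrier tends to the positive constant `smoothRamp 1` and
its gradient to `0`, so what survives is that constant times the pairing. -/
lemma laplacianPairing_cutoff_nonpos (h : IsPuncturedSupersolution Ω w g) (h0 : (0 : E4) ∈ Ω)
    (hR : 0 < R) (hRΩ : Metric.closedBall (0 : E4) R ⊆ Ω) :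
    laplacianPairing Ω w g (cutoff R) ≤ 0 := by
  obtain ⟨K, hK, hb⟩ := exists_cutoff_barrier_bound hR
  obtain ⟨hw, hg⟩ := h.locallyIntegrableOn h0
  set ε : ℕ → ℝ := fun n => 1 / ((n : ℝ) + 1) with hε
  have hεpos : ∀ n, 0 < ε n := fun n => by positivity
  have hεle : ∀ n, ε n ≤ 1 := fun n => by
    rw [hε]
    exact div_le_one_of_le₀ (by linarith [n.cast_nonneg (α := ℝ)]) (by positivity)
  have hεlim : Tendsto ε atTop (𝓝 0) := tendsto_div_nat_succ 1
  have hbn := fun n => hb 0 (ε n) le_rfl zero_le_one (hεpos n) (hεle n)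
  have hq : ∀ n, ContDiff ℝ ∞ (barrier 0 (ε n)) := fun n =>
    contDiff_barrier zero_le_one (hεpos n) (hεle n)
  have hq0 : ∀ n, barrier 0 (ε n) =ᶠ[𝓝 0] fun _ => 0 := fun n =>
    barrier_eventuallyEq_zero zero_le_one (hεpos n) (hεle n)
  have hη := isTestFunction_cutoff hR hRΩ
  have hgη : IntegrableOn (fun x => g x * cutoff R x) (punctured Ω : Set E4) := by
    rw [IntegrableOn, restrict_punctured]
    exact hg.integrableOn_mul_of_tsupport_subset hη.contDiff.continuous hη.hasCompactSupport
      hη.tsupport_subset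
  have hwi := h.integrableOn_indicator hR hRΩ K
  -- The integrand of the tested equation without the term `w * cutoff * Δ barrier`. The function
  -- `D` below dominates it for every `n`.
  set G : ℕ → E4 → ℝ := fun n x => g x * cutoff R x * barrier 0 (ε n) x +
    (w x * (2 * gradDot (cutoff R) (barrier 0 (ε n)) x) +
      w x * (barrier 0 (ε n) x * Δ (cutoff R) x)) with hG
  set D : E4 → ℝ := fun x => g x * cutoff R x +
    (w x * (cutoffAnnulus R).indicator (fun _ => K) x +
      w x * (cutoffAnnulus R).indicator (fun _ => K) x) with hD
  have hDi : IntegrableOn D (punctured Ω : Set E4) := hgη.add (hwi.add hwi)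
  have hGm : ∀ n, AEStronglyMeasurable (G n) (volume.restrict (punctured Ω : Set E4)) := fun n =>
    (hgη.aestronglyMeasurable.mul (hq n).continuous.aestronglyMeasurable).add
      ((h.left.aestronglyMeasurable.mul (continuous_const.mul
        (continuous_gradDot hη.contDiff (hq n))).aestronglyMeasurable).add
      (h.left.aestronglyMeasurable.mul ((hq n).continuous.mul
        (contDiff_laplacian hη.contDiff).continuous).aestronglyMeasurable))
  have hGD : ∀ n, ∀ᵐ x ∂(volume.restrict (punctured Ω : Set E4)), ‖G n x‖ ≤ D x := fun n => by
    filter_upwards [h.left_nonneg, h.right_nonneg] with x hwx hgx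
    refine (norm_add_le _ _).trans (add_le_add ?_ ((norm_add_le _ _).trans (add_le_add
      (abs_mul_le_mul_indicator hwx (hbn n x).1) (abs_mul_le_mul_indicator hwx (hbn n x).2))))
    have h1 : 0 ≤ g x * cutoff R x := mul_nonneg hgx (cutoff_nonneg _ _)
    rw [Real.norm_of_nonneg (mul_nonneg h1 (barrier_nonneg _ _ _))]
    refine mul_le_of_le_one_right h1 ?_
    simpa using barrier_le le_rfl (ε n) x
  have hGi : ∀ n, IntegrableOn (G n) (punctured Ω : Set E4) := fun n =>
    Integrable.mono' hDi (hGm n) (hGD n)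
  have hGlim : Tendsto (fun n => ∫ x in (punctured Ω : Set E4), G n x) atTop
      (𝓝 (∫ x in (punctured Ω : Set E4),
        smoothRamp 1 * (w x * Δ (cutoff R) x + g x * cutoff R x))) := by
    refine tendsto_integral_of_dominated_convergence D hGm hDi hGD ?_
    filter_upwards [ae_restrict_mem (punctured Ω).isOpen.measurableSet] with x hx
    have l1 := tendsto_barrier_zero hx.2 hεlim
    have l2 : Tendsto (fun n => gradDot (cutoff R) (barrier 0 (ε n)) x) atTop (𝓝 0) := by
      have l3 : Tendsto (fun n => 4 * (‖fderiv ℝ (cutoff R) x‖ *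
          (0 + 2 * ε n ^ 2 * (‖x‖ ^ 3)⁻¹))) atTop (𝓝 0) := by
        have := (((((hεlim.pow 2).const_mul 2).mul_const (‖x‖ ^ 3)⁻¹).const_add 0).const_mul
          ‖fderiv ℝ (cutoff R) x‖).const_mul 4
        simpa using this
      refine squeeze_zero_norm (fun n => (abs_gradDot_le _ _ _).trans ?_) l3
      refine mul_le_mul_of_nonneg_left (mul_le_mul_of_nonneg_left
        (norm_fderiv_barrier_le le_rfl _ hx.2) (norm_nonneg _)) (by norm_num)
    have l4 := (l1.const_mul (g x * cutoff R x)).add (((l2.const_mul 2).const_mul (w x)).add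
      ((l1.mul_const (Δ (cutoff R) x)).const_mul (w x)))
    convert l4 using 2
    ring
  have hGle : ∀ n, ∫ x in (punctured Ω : Set E4), G n x ≤ 0 := fun n => by
    rw [← h.integral_cutoff_mul_eq_zero hR hRΩ (hq n) (hq0 n)]
    refine integral_mono_ae (hGi n) ?_ ?_
    · have h1 : IntegrableOn (fun x => w x * (cutoff R x * Δ (barrier 0 (ε n)) x))
          (punctured Ω : Set E4) := by
        refine h.left.integrableOn_mul_of_tsupport_subset
          (hη.contDiff.continuous.mul (contDiff_laplacian (hq n)).continuous)
          hη.hasCompactSupport.mul_right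
          (tsupport_mul_subset_punctured hη.tsupport_subset ?_)
        filter_upwards [(hq0 n).eventuallyEq_nhds] with y hy
        exact laplacian_eq_zero_of_eventuallyEq_const hy
      refine (h1.add (hGi n)).congr (Eventually.of_forall fun x => ?_)
      simp only [hG, Pi.add_apply]
      ring
    · filter_upwards [h.left_nonneg, ae_restrict_mem (punctured Ω).isOpen.measurableSet]
        with x hwx hx
      have h1 : 0 ≤ w x * (cutoff R x * Δ (barrier 0 (ε n)) x) :=
        mul_nonneg hwx (mul_nonneg (cutoff_nonneg _ _) (laplacian_barrier_nonneg le_rfl _ hx.2))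
      simp only [hG]
      linarith
  have h1 := le_of_tendsto' hGlim hGle
  rw [integral_const_mul, restrict_punctured] at h1
  exact nonpos_of_mul_nonpos_right h1 smoothRamp_one_pos

/-- The Brezis–Lions theorem: a nonnegative supersolution in the punctured domain extends across
the puncture up to a nonnegative multiple of the Dirac mass. -/
theorem exists_dirac (h : IsPuncturedSupersolution Ω w g) (h0 : (0 : E4) ∈ Ω) :
    ∃ α : ℝ, 0 ≤ α ∧ ∀ φ, IsTestFunction Ω φ → laplacianPairing Ω w g φ = -(α * φ 0) := by
  obtain ⟨R, hR, -, hRΩ⟩ := exists_closedBall_subset h0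
  obtain ⟨hw, hg⟩ := h.locallyIntegrableOn h0
  have hη := isTestFunction_cutoff hR hRΩ
  refine ⟨-laplacianPairing Ω w g (cutoff R),
    neg_nonneg.2 (h.laplacianPairing_cutoff_nonpos h0 hR hRΩ), fun φ hφ => ?_⟩
  -- Subtracting `φ 0` times the cutoff, which equals one at `0`, leaves a test function vanishing
  -- at the origin.
  have hφη : IsTestFunction Ω (fun x => φ 0 * cutoff R x) := hη.mul_left contDiff_const
  have h1 := h.laplacianPairing_eq_zero h0 (hφ.sub hφη) (by
    simp [cutoff_eq_one hR (x := 0) (by rw [norm_zero]; positivity)])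
  rw [laplacianPairing_sub hw hg hφ hφη, laplacianPairing_const_mul _ hη.contDiff] at h1
  linarith

/-- A supersolution that is square integrable near the origin has no Dirac mass there. -/
theorem eq_zero_of_integrableOn_sq (h : IsPuncturedSupersolution Ω w g) (h0 : (0 : E4) ∈ Ω)
    {α : ℝ} (hα : 0 ≤ α)
    (hT : ∀ φ, IsTestFunction Ω φ → laplacianPairing Ω w g φ = -(α * φ 0)) {r : ℝ} (hr : 0 < r)
    (hsq : IntegrableOn (fun x => w x ^ 2) (Metric.closedBall 0 r)) : α = 0 := by
  obtain ⟨R, hR, hR1, hRΩ⟩ := exists_closedBall_subset h0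
  obtain ⟨hw, hg⟩ := h.locallyIntegrableOn h0
  obtain ⟨N, hN, hηN⟩ := exists_cutoff_bound
  set s : ℝ := min r R with hs
  have hspos : 0 < s := lt_min hr hR
  have hsΩ : Metric.closedBall (0 : E4) s ⊆ Ω :=
    (Metric.closedBall_subset_closedBall (min_le_right _ _)).trans hRΩ
  set V : ℝ := volume.real (Metric.closedBall (0 : E4) 1) with hV
  have hV0 : 0 ≤ V := measureReal_nonneg
  -- Young's inequality with a free parameter `l` replaces Cauchy–Schwarz: the `L²` part disappears
  -- as `ε → 0` with `l` fixed, and the remainder `N * V / l` is then made small by choosing `l`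
  -- large.
  have key : ∀ l : ℝ, 0 < l → α ≤ N * V / l := by
    intro l hl
    set H : E4 → ℝ := fun x => N * l * w x ^ 2 + g x with hH
    have hHi : IntegrableOn H (Metric.closedBall 0 s) :=
      ((hsq.mono_set (Metric.closedBall_subset_closedBall (min_le_left _ _))).const_mul _).add
        (hg.integrableOn_compact_subset hsΩ (isCompact_closedBall _ _))
    have hlim := (tendsto_setIntegral_closedBall hHi hspos).add_const (N * V / l)
    rw [zero_add] at hlim
    refine ge_of_tendsto' hlim fun n => ?_
    set ε : ℝ := s / (n + 1) with hε
    have hεpos : 0 < ε := by positivity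
    have hεs : ε ≤ s := div_le_self hspos.le (by linarith [n.cast_nonneg (α := ℝ)])
    have hsub : Metric.closedBall (0 : E4) ε ⊆ Metric.closedBall 0 s :=
      Metric.closedBall_subset_closedBall hεs
    have hci : IntegrableOn (fun _ : E4 => N * ε⁻¹ ^ 4 / l) (Metric.closedBall 0 ε) :=
      integrableOn_const measure_closedBall_lt_top.ne
    have hb := abs_laplacianPairing_le (w := w) (g := g) (φ := cutoff ε)
      (H := fun x => H x + N * ε⁻¹ ^ 4 / l) (hsub.trans hsΩ) ((hHi.mono_set hsub).add hci) (by
      rw [← restrict_punctured]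
      filter_upwards [h.left_nonneg, h.right_nonneg] with x hwx hgx
      by_cases hxε : ‖x‖ ≤ ε
      · rw [indicator_of_mem (mem_closedBall_zero_iff.2 hxε)]
        have b1 : |w x * Δ (cutoff ε) x| ≤ N * (l * w x ^ 2 + ε⁻¹ ^ 4 / l) := by
          rw [abs_mul, abs_of_nonneg hwx]
          calc w x * |Δ (cutoff ε) x| ≤ w x * (N * ε⁻¹ ^ 2) :=
                mul_le_mul_of_nonneg_left (hηN ε hεpos x).2 hwx
            _ = N * (w x * ε⁻¹ ^ 2) := by ring
            _ ≤ _ := by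
              refine mul_le_mul_of_nonneg_left ?_ hN
              rw [← sub_nonneg]
              have h1 : l * w x ^ 2 + ε⁻¹ ^ 4 / l - w x * ε⁻¹ ^ 2 =
                  ((l * w x - ε⁻¹ ^ 2 / 2) ^ 2 + 3 / 4 * ε⁻¹ ^ 4) / l := by
                field_simp
                ring
              rw [h1]
              positivity
        have b2 : |g x * cutoff ε x| ≤ g x := by
          rw [abs_mul, abs_of_nonneg hgx, abs_of_nonneg (cutoff_nonneg _ _)]
          exact mul_le_of_le_one_right hgx (cutoff_le_one _ _)
        refine (abs_add_le _ _).trans ((add_le_add b1 b2).trans (le_of_eq ?_))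
        rw [hH]
        ring
      · have hz := cutoff_eventuallyEq_zero hεpos (not_le.1 hxε)
        rw [indicator_of_notMem (by rwa [mem_closedBall_zero_iff]),
          laplacian_eq_zero_of_eventuallyEq_const hz, hz.eq_of_nhds]
        simp)
    rw [hT _ (isTestFunction_cutoff hεpos (hsub.trans hsΩ)),
      cutoff_eq_one hεpos (by rw [norm_zero]; positivity), mul_one, abs_neg, abs_of_nonneg hα,
      integral_add (hHi.mono_set hsub) hci, setIntegral_const] at hb
    -- The factor `ε ^ 4` cancels the `ε⁻¹ ^ 4` from Young's inequality; this is where dimension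
    -- four is critical.
    have hvol : volume.real (Metric.closedBall (0 : E4) ε) = ε ^ 4 * V := by
      rw [hV, Measure.real, Measure.real, Measure.addHaar_closedBall' volume (0 : E4) hεpos.le,
        ENNReal.toReal_mul, ENNReal.toReal_ofReal (by positivity)]
      simp
    rw [hvol, smul_eq_mul] at hb
    refine hb.trans (add_le_add le_rfl (le_of_eq ?_))
    field_simp
  by_contra hne
  have hαpos : 0 < α := lt_of_le_of_ne hα (Ne.symm hne)
  have hNV : 0 ≤ N * V := mul_nonneg hN hV0
  -- This choice of `l` would give `α ≤ α * N * V / (N * V + 1) < α`.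
  have h1 := key ((N * V + 1) / α) (by positivity)
  rw [div_div_eq_mul_div, le_div_iff₀ (by positivity)] at h1
  nlinarith

end IsPuncturedSupersolution


/-! ### Application to problem (P) -/

/-- The test function in `𝓓(Ω)` given by `IsTestFunction`. -/
def IsTestFunction.toTestFunction {Ω : Opens E4} {φ : E4 → ℝ} (h : IsTestFunction Ω φ) : 𝓓(Ω, ℝ) :=
  ⟨φ, h.contDiff, h.hasCompactSupport, h.tsupport_subset⟩

lemma isTestFunction_coe {Ω : Opens E4} (φ : 𝓓(Ω, ℝ)) : IsTestFunction Ω φ :=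
  ⟨φ.contDiff, φ.hasCompactSupport, φ.tsupport_subset⟩

lemma IsTestFunction.laplacian {Ω : Opens E4} {φ : E4 → ℝ} (h : IsTestFunction Ω φ) :
    IsTestFunction Ω (Δ φ) :=
  ⟨contDiff_laplacian h.contDiff, hasCompactSupport_laplacian h.hasCompactSupport,
    (tsupport_laplacian_subset φ).trans h.tsupport_subset⟩

lemma laplacianPairing_eq_add {Ω : Opens E4} {w g φ : E4 → ℝ}
    (hw : LocallyIntegrableOn w (Ω : Set E4)) (hg : LocallyIntegrableOn g (Ω : Set E4))
    (hφ : IsTestFunction Ω φ) :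
    laplacianPairing Ω w g φ =
      (∫ x in (Ω : Set E4), w x * Δ φ x) + ∫ x in (Ω : Set E4), g x * φ x :=
  integral_add
    (hw.integrableOn_mul_of_tsupport_subset hφ.laplacian.contDiff.continuous
      hφ.laplacian.hasCompactSupport hφ.laplacian.tsupport_subset)
    (hg.integrableOn_mul_of_tsupport_subset hφ.contDiff.continuous hφ.hasCompactSupport
      hφ.tsupport_subset)

section Problem

variable {Ω : Opens E4} {u v a : E4 → ℝ} {f : ℝ → ℝ}

lemma isPuncturedSupersolution_of_hasWeakLaplacian (hv : HasWeakLaplacian (punctured Ω) u v)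
    (hu0 : ∀ᵐ x ∂(volume.restrict (punctured Ω : Set E4)), 0 ≤ u x)
    (hv0 : ∀ᵐ x ∂(volume.restrict (punctured Ω : Set E4)), 0 ≤ -v x) :
    IsPuncturedSupersolution Ω u (-v) := by
  refine ⟨hv.locallyIntegrableOn_left, hv.locallyIntegrableOn_right.neg, hu0, hv0,
    fun φ h1 h2 h3 => ?_⟩
  have hφ : IsTestFunction (punctured Ω) φ := ⟨h1, h2, h3⟩
  have h := laplacianPairing_eq_add hv.locallyIntegrableOn_left hv.locallyIntegrableOn_right.neg hφ
  rw [laplacianPairing] at h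
  have h4 := hv.integral_eq hφ.toTestFunction
  change ∫ x in (punctured Ω : Set E4), u x * Δ φ x = ∫ x in (punctured Ω : Set E4), v x * φ x at h4
  rw [h, h4]
  simp only [Pi.neg_apply, neg_mul, integral_neg, add_neg_cancel]

/-- The weak equation for `v` is obtained by testing `Δ u = v` with `Δ φ` and comparing with the
weak biharmonic equation tested with `φ`. -/
lemma isPuncturedSupersolution_of_hasWeakBilaplacian {g : E4 → ℝ}
    (hv : HasWeakLaplacian (punctured Ω) u v) (hg : HasWeakBilaplacian (punctured Ω) u g)
    (hv0 : ∀ᵐ x ∂(volume.restrict (punctured Ω : Set E4)), 0 ≤ -v x)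
    (hg0 : ∀ᵐ x ∂(volume.restrict (punctured Ω : Set E4)), 0 ≤ g x) :
    IsPuncturedSupersolution Ω (-v) g := by
  refine ⟨hv.locallyIntegrableOn_right.neg, hg.locallyIntegrableOn_right, hv0, hg0,
    fun φ h1 h2 h3 => ?_⟩
  have hφ : IsTestFunction (punctured Ω) φ := ⟨h1, h2, h3⟩
  have h := laplacianPairing_eq_add hv.locallyIntegrableOn_right.neg
    hg.locallyIntegrableOn_right hφ
  rw [laplacianPairing] at h
  have h4 := hv.integral_eq hφ.laplacian.toTestFunction
  have h5 := hg.integral_eq hφ.toTestFunction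
  change ∫ x in (punctured Ω : Set E4), u x * Δ (Δ φ) x =
    ∫ x in (punctured Ω : Set E4), v x * Δ φ x at h4
  change ∫ x in (punctured Ω : Set E4), u x * Δ (Δ φ) x =
    ∫ x in (punctured Ω : Set E4), g x * φ x at h5
  rw [h, ← h5, h4]
  simp only [Pi.neg_apply, neg_mul, integral_neg, neg_add_cancel]

/-- A real `b` strictly between `0` and `c` exists for infinite `c` as well, so both cases of the
limit are treated together. -/
lemma exists_le_of_tendsto_div_sq {c : EReal} (hc : 0 < c)
    (hlim : Tendsto (fun t : ℝ => ((f t / t ^ 2 : ℝ) : EReal)) atTop (𝓝 c)) :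
    ∃ b > 0, ∃ t₀ > 0, ∀ t, t₀ ≤ t → b * t ^ 2 ≤ f t := by
  obtain ⟨b, hb0, hbc⟩ := EReal.lt_iff_exists_real_btwn.1 hc
  obtain ⟨t₀, ht₀⟩ := eventually_atTop.1 (hlim.eventually_const_lt hbc)
  refine ⟨b, EReal.coe_pos.1 hb0, max t₀ 1, lt_max_of_lt_right one_pos, fun t ht => ?_⟩
  have ht1 : 0 < t := one_pos.trans_le ((le_max_right _ _).trans ht)
  have := EReal.coe_lt_coe_iff.1 (ht₀ t ((le_max_left _ _).trans ht))
  rw [lt_div_iff₀ (by positivity)] at this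
  exact this.le

/-- Near the origin, `u² ≤ t₀²` where `u ≤ t₀`, while elsewhere `m b u² ≤ a f(u)`. Both bounds are
integrable on a small ball. -/
lemma exists_integrableOn_sq (h0 : (0 : E4) ∈ Ω) (hf : IsNonlinearity f) (ha : IsWeight Ω a)
    {b t₀ : ℝ} (hb : 0 < b) (ht₀ : 0 < t₀) (hbf : ∀ t, t₀ ≤ t → b * t ^ 2 ≤ f t)
    (hu0 : ∀ᵐ x ∂(volume.restrict (Ω : Set E4)), 0 ≤ u x)
    (hu : LocallyIntegrableOn u (Ω : Set E4))
    (hg : LocallyIntegrableOn (fun x => a x * f (u x)) (Ω : Set E4)) :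
    ∃ r > 0, IntegrableOn (fun x => u x ^ 2) (Metric.closedBall 0 r) := by
  obtain ⟨r₀, hr₀, m, hm, hma⟩ := ha.essInf_pos
  obtain ⟨R, hR, -, hRΩ⟩ := exists_closedBall_subset h0
  set r : ℝ := min R (r₀ / 2) with hr
  have hrpos : 0 < r := lt_min hR (half_pos hr₀)
  have hrΩ : Metric.closedBall (0 : E4) r ⊆ Ω :=
    (Metric.closedBall_subset_closedBall (min_le_left _ _)).trans hRΩ
  have hrr : Metric.closedBall (0 : E4) r ⊆ Metric.ball 0 r₀ ∩ Ω := fun x hx =>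
    ⟨Metric.closedBall_subset_ball ((min_le_right _ _).trans_lt (half_lt_self hr₀)) hx, hrΩ hx⟩
  have hci : IntegrableOn (fun _ : E4 => t₀ ^ 2) (Metric.closedBall 0 r) :=
    integrableOn_const measure_closedBall_lt_top.ne
  have hgi := hg.integrableOn_compact_subset hrΩ (isCompact_closedBall _ _)
  have hui := hu.integrableOn_compact_subset hrΩ (isCompact_closedBall _ _)
  refine ⟨r, hrpos, Integrable.mono' (hci.add (hgi.const_mul (m * b)⁻¹))
    (hui.aestronglyMeasurable.pow 2) ?_⟩
  filter_upwards [ae_mono (Measure.restrict_mono_set _ hrΩ) hu0,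
    ae_mono (Measure.restrict_mono_set _ hrr) hma] with x hux hax
  rw [Real.norm_of_nonneg (sq_nonneg _)]
  simp only [Pi.add_apply]
  have hf0 : 0 ≤ f (u x) := hf.nonneg _ hux
  have ha0 : 0 ≤ a x := hm.le.trans hax
  rcases le_total t₀ (u x) with h | h
  · have h1 : u x ^ 2 ≤ (m * b)⁻¹ * (a x * f (u x)) := by
      rw [le_inv_mul_iff₀ (by positivity)]
      calc m * b * u x ^ 2 = m * (b * u x ^ 2) := by ring
        _ ≤ a x * f (u x) := mul_le_mul hax (hbf _ h) (by positivity) ha0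
    nlinarith [sq_nonneg t₀]
  · have h1 : 0 ≤ (m * b)⁻¹ * (a x * f (u x)) := by positivity
    nlinarith

/-- A test function equal to `|x|²` near `0` vanishes there and has Laplacian `8`, so it isolates
the coefficient of `Δ δ₀`. -/
lemma SolvesWithDirac.eq_of_eq {α β α' β' : ℝ} (h0 : (0 : E4) ∈ Ω)
    (h : SolvesWithDirac Ω a f u α β) (h' : SolvesWithDirac Ω a f u α' β') : β = β' := by
  obtain ⟨R, hR, -, hRΩ⟩ := exists_closedBall_subset h0
  have hφ : IsTestFunction Ω (fun x => ‖x‖ ^ 2 * cutoff R x) :=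
    (isTestFunction_cutoff hR hRΩ).mul_left (contDiff_norm_sq ℝ)
  have h1 := (h.integral_eq hφ.toTestFunction).symm.trans (h'.integral_eq hφ.toTestFunction)
  have h2 : hφ.toTestFunction (0 : E4) = 0 := by
    change ‖(0 : E4)‖ ^ 2 * cutoff R 0 = 0
    simp
  have h3 : Δ (hφ.toTestFunction : E4 → ℝ) 0 = 8 := by
    rw [← laplacian_normSq 0]
    refine laplacian_eq_of_eventuallyEq ?_
    filter_upwards [cutoff_eventuallyEq_one (x := 0) hR (by rw [norm_zero]; positivity)] with x hx
    change ‖x‖ ^ 2 * cutoff R x = ‖x‖ ^ 2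
    rw [hx, mul_one]
  rw [h2, h3] at h1
  linarith

end Problem

theorem lemma3p1 (Ω : Opens E4) (hbdd : Bornology.IsBounded (Ω : Set E4)) (h0 : (0 : E4) ∈ Ω)
    (f : ℝ → ℝ) (hf : IsNonlinearity f)
    (a : E4 → ℝ) (ha : IsWeight Ω a)
    (c : EReal) (hc : 0 < c)
    (hlim : Tendsto (fun t : ℝ => ((f t / t ^ 2 : ℝ) : EReal)) atTop (𝓝 c))
    (u : E4 → ℝ) (hu : SolvesP Ω a f u) :
    (∀ α β : ℝ, SolvesWithDirac Ω a f u α β → β = 0) ∧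
      ∃ α : ℝ, 0 ≤ α ∧ SolvesWithDirac Ω a f u α 0 := by
  obtain ⟨v, hv, hv0⟩ := hu.neg_laplacian_nonneg
  have hu0 := hu.nonneg
  have hg0 : ∀ᵐ x ∂(volume.restrict (punctured Ω : Set E4)), 0 ≤ a x * f (u x) := by
    have ha0 := ha.nonneg
    rw [← restrict_punctured] at ha0
    filter_upwards [hu0, ha0] with x hux hax using mul_nonneg hax (hf.nonneg _ hux)
  have hsu := isPuncturedSupersolution_of_hasWeakLaplacian hv hu0 hv0
  have hsv := isPuncturedSupersolution_of_hasWeakBilaplacian hv hu.bilaplacian_eq hv0 hg0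
  obtain ⟨huΩ, hvΩ⟩ := hsu.locallyIntegrableOn h0
  obtain ⟨-, hgΩ⟩ := hsv.locallyIntegrableOn h0
  obtain ⟨α, hα, hT⟩ := hsv.exists_dirac h0
  obtain ⟨β, hβ, hTu⟩ := hsu.exists_dirac h0
  obtain ⟨b, hb, t₀, ht₀, hbf⟩ := exists_le_of_tendsto_div_sq hc hlim
  rw [restrict_punctured] at hu0
  obtain ⟨r, hr, hsq⟩ := exists_integrableOn_sq h0 hf ha hb ht₀ hbf hu0 huΩ hgΩ
  have hβ0 : β = 0 := hsu.eq_zero_of_integrableOn_sq h0 hβ hTu hr hsq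
  have hmain : SolvesWithDirac Ω a f u α 0 := by
    refine ⟨huΩ, hgΩ, fun φ => ?_⟩
    have hφ := isTestFunction_coe φ
    -- The equation for `u` is tested with `Δ φ` and the one for `v` with `φ`; once `β = 0`, adding
    -- them eliminates `∫ v Δφ`.
    have h1 := hTu _ hφ.laplacian
    have h2 := hT _ hφ
    rw [laplacianPairing_eq_add huΩ hvΩ hφ.laplacian, hβ0] at h1
    rw [laplacianPairing_eq_add hvΩ hgΩ hφ] at h2
    linarith
  exact ⟨fun _ _ h => h.eq_of_eq h0 hmain, α, hα, hmain⟩
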